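/- Let $(\lambda_n)_{n\ge1}$, $(\mu_n)_{n\ge1}$ be strictly increasing sequences of positive reals tending to $\infty$ and let $(a_n)$, $(b_n)$ be complex sequences such that $\phi(s)=\sum a_n\lambda_n^{-s}$ and $\psi(s)=\sum b_n\mu_n^{-s}$ have finite abscissae of absolute convergence $\sigma_a,\sigma_b$. Let $\delta>0$, $Q>0$, $\omega\in\mathbb C$ with $|\omega|=1$, $\alpha_1,\dots,\alpha_r>0$, $\beta_1,\dots,\beta_r\in\mathbb C$ with $\Re\beta_i\ge0$, and $d'=\sum_i\alpha_i$. Assume that $F(s)=\phi(s)\prod_{i=1}^r\Gamma(\alpha_is+\beta_i)$ continues analytically to the complement of a compact set $K$; the continuation of $\phi$ is then $F(s)/\prod_i\Gamma(\alpha_is+\beta_i)$. Let $c>\max\{0,\sigma_a,\sigma_b\}$ with $c\notin\{\delta,\delta+1,\delta+2,\dots\}$, and let $C$ be a positively oriented circle which lies in the strip $\delta-c<\Re(s)<c$ and encloses $K$ and all singularities of $\Gamma(s)F(s)$ in this strip (so all singularities of $F$ lie in the strip). Let $\rho\ge0$, $\rho>(2\sigma_b-\delta)d'-\tfrac12$,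 be such that the line integrals below converge absolutely, and suppose that the Riesz-sum identity of order $\rho$ holds for every $x>0$: $$\frac1{\Gamma(\rho+1)}\sideset{}{'}\sum_{\lambda_n\le x}a_n(x-\lambda_n)^\rho=Q_\rho(x)+\frac{\omega x^{\delta+\rho}}{Q^\delta}\sum_{n=1}^\infty\overline{b_n}\,\frac1{2\pi i}\int_{c-i\infty}^{c+i\infty}\frac{\Gamma(\delta-s)\prod_{i=1}^r\Gamma(\alpha_is+\overline{\beta_i})}{\Gamma(1+\delta-s+\rho)\prod_{i=1}^r\Gamma(\alpha_i(\delta-s)+\beta_i)}\Big(\frac{\mu_nx}{Q^2}\Big)^{-s}ds,$$ where the dash means that the last term is halved if $\rho=0$ and $x=\lambda_n$, and $$Q_\rho(x)=\frac1{2\pi i}\int_C\frac{\phi(s)\Gamma(s)x^{s+\rho}}{\Gamma(s+\rho+1)}\,ds .$$ Then for every $x>0$ $$\sum_{n=1}^\infty a_nY_{\alpha,\beta}(\lambda_nx)=P_1(x)+\frac{\omega}{(xQ)^\delta}\sum_{n=1}^\infty\overline{b_n}\,X_{\alpha,\bar\beta}\Big(\frac{\mu_n}{Q^2x}\Big),$$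 where both series and the integrals defining $X$ and $Y$ converge absolutely and, for $y>0$, $$Y_{\alpha,\beta}(y)=\frac1{2\pi i}\int_{c-i\infty}^{c+i\infty}\Gamma(s)\prod_{i=1}^r\Gamma(\alpha_is+\beta_i)\,y^{-s}ds,\qquad X_{\alpha,\bar\beta}(y)=\frac1{2\pi i}\int_{c-i\infty}^{c+i\infty}\Gamma(\delta-s)\prod_{i=1}^r\Gamma(\alpha_is+\overline{\beta_i})\,y^{-s}ds,$$ $$P_1(x)=\frac1{2\pi i}\int_C\Gamma(s)F(s)x^{-s}ds .$$ -/

import Mathlib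

open Complex Filter MeasureTheory
open scoped ComplexConjugate

noncomputable section

namespace RieszModular

/-- A frequency sequence `ν₁ < ν₂ < ⋯` of positive reals tending to infinity.
Sequences are indexed by `ℕ`, so that the entry of index `n` is the usual `(n+1)`-st one. -/
structure IsFrequency (ν : ℕ → ℝ) : Prop where
  pos : ∀ n, 0 < ν n
  strictMono : StrictMono ν
  tendsto : Tendsto ν atTop atTop

/-- `σ` is the (finite) abscissa of absolute convergence of `∑ u_n ν_n^{-s}`. In `ℝ` the empty set
and sets that are unbounded below have no greatest lower bound, so finiteness is included. -/
def IsAbscissa (u : ℕ → ℂ) (ν : ℕ → ℝ) (σ : ℝ) : Prop :=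
  IsGLB {τ : ℝ | Summable fun n => ‖u n‖ * ν n ^ (-τ)} σ

/-- The Dirichlet series `∑ u_n ν_n^{-s}`. -/
def dirichletSeries (u : ℕ → ℂ) (ν : ℕ → ℝ) (s : ℂ) : ℂ :=
  ∑' n, u n * (ν n : ℂ) ^ (-s)

/-- The product of Gamma factors `∏ Γ(α_i s + β_i)`. -/
def gammaProd {r : ℕ} (α : Fin r → ℝ) (β : Fin r → ℂ) (s : ℂ) : ℂ :=
  ∏ i, Gamma ((α i : ℂ) * s + β i)

/-- `F` is the analytic continuation of `φ(s) ∏ Γ(α_i s + β_i)`, where `φ(s) = ∑ a_n λ_n^{-s}`, to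
the exterior of the compact set `K`. On `Re s > max(0, σa)` the series converges absolutely and the
Gamma factors have no poles. -/
structure IsCompletedContinuation {r : ℕ} (a : ℕ → ℂ) (lam : ℕ → ℝ) (σa : ℝ)
    (α : Fin r → ℝ) (β : Fin r → ℂ) (K : Set ℂ) (F : ℂ → ℂ) : Prop where
  isCompact : IsCompact K
  differentiableOn : DifferentiableOn ℂ F Kᶜ
  eq_series : ∀ s ∈ Kᶜ, max 0 σa < s.re → F s = dirichletSeries a lam s * gammaProd α β s

/-- The circle with centre `z₀` and radius `R > 0` lies in the strip `δ - c < Re s < c`, and it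
encloses the set `K` of singularities of `F` as well as every singularity of `Γ(s) F(s)` in that
strip. Off `K`, the singularities of `Γ F` are the points `-k` (`k = 0, 1, 2, …`) with
`F (-k) ≠ 0`. -/
structure IsAdmissibleCircle (δ c : ℝ) (K : Set ℂ) (F : ℂ → ℂ) (z₀ : ℂ) (R : ℝ) : Prop where
  radius_pos : 0 < R
  subset_strip : Metric.closedBall z₀ R ⊆ {s : ℂ | δ - c < s.re ∧ s.re < c}
  singularities_inside : K ⊆ Metric.ball z₀ R
  gamma_poles_inside : ∀ k : ℕ, δ - c < -(k : ℝ) → F (-(k : ℂ)) ≠ 0 →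
    -(k : ℂ) ∈ Metric.ball z₀ R

/-- The Riesz mean `(1 / Γ(ρ+1)) ∑'_{λ_n ≤ x} a_n (x - λ_n)^ρ`, where the dash means that the last
term is halved if `ρ = 0` and `x = λ_n`. Only finitely many terms are non-zero. -/
def rieszMean (a : ℕ → ℂ) (lam : ℕ → ℝ) (ρ x : ℝ) : ℂ :=
  1 / Gamma ((ρ : ℂ) + 1) *
    ∑' n, if lam n ≤ x then
      (if ρ = 0 ∧ lam n = x then (1 / 2 : ℂ) else 1) * a n * (((x - lam n) ^ ρ : ℝ) : ℂ)
    else 0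

/-- The continuation of `φ` itself, `φ(s) = F(s) / ∏ Γ(α_i s + β_i)`; as `1 / Γ` is entire and
`Gamma` takes the value `0` at its poles, the quotient is also right at the poles of the Gamma
factors. -/
def phiCont {r : ℕ} (α : Fin r → ℝ) (β : Fin r → ℂ) (F : ℂ → ℂ) (s : ℂ) : ℂ :=
  F s / gammaProd α β s

/-- `Q_ρ(x) = (1 / 2πi) ∮ φ(s) Γ(s) x^{s+ρ} / Γ(s+ρ+1) ds` over the circle. -/
def residualQ {r : ℕ} (α : Fin r → ℝ) (β : Fin r → ℂ) (F : ℂ → ℂ) (z₀ : ℂ) (R ρ x : ℝ) : ℂ :=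
  (2 * Real.pi * I : ℂ)⁻¹ *
    ∮ s in C(z₀, R), phiCont α β F s * Gamma s * (x : ℂ) ^ (s + ρ) / Gamma (s + ρ + 1)

/-- `P₁(x) = (1 / 2πi) ∮ Γ(s) F(s) x^{-s} ds` over the circle. -/
def residualP₁ (F : ℂ → ℂ) (z₀ : ℂ) (R x : ℝ) : ℂ :=
  (2 * Real.pi * I : ℂ)⁻¹ * ∮ s in C(z₀, R), Gamma s * F s * (x : ℂ) ^ (-s)

/-- The Gamma quotient in the Riesz sum identity. -/
def rieszKernel {r : ℕ} (α : Fin r → ℝ) (β : Fin r → ℂ) (δ ρ : ℝ) (s : ℂ) : ℂ :=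
  Gamma (δ - s) * gammaProd α (fun i => conj (β i)) s /
    (Gamma (1 + δ - s + ρ) * gammaProd α β (δ - s))

/-- The Riesz sum identity of order `ρ` for all `x > 0`. Here
`mellinInv c f y = (1 / 2πi) ∫_{c - i∞}^{c + i∞} f(s) y^{-s} ds`, and the first clause says that
these line integrals converge (absolutely). -/
def RieszSumIdentity {r : ℕ} (a b : ℕ → ℂ) (lam mu : ℕ → ℝ) (α : Fin r → ℝ) (β : Fin r → ℂ)
    (δ Q : ℝ) (ω : ℂ) (F : ℂ → ℂ) (c : ℝ) (z₀ : ℂ) (R ρ : ℝ) : Prop :=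
  VerticalIntegrable (rieszKernel α β δ ρ) c ∧
  ∀ x : ℝ, 0 < x →
    rieszMean a lam ρ x =
      residualQ α β F z₀ R ρ x +
        ω * ((x ^ (δ + ρ) / Q ^ δ : ℝ) : ℂ) *
          ∑' n, conj (b n) * mellinInv c (rieszKernel α β δ ρ) (mu n * x / Q ^ 2)

/-- The Mellin transform `Γ(s) ∏ Γ(α_i s + β_i)` of `Y_{α,β}`. -/
def kernelY {r : ℕ} (α : Fin r → ℝ) (β : Fin r → ℂ) (s : ℂ) : ℂ :=
  Gamma s * gammaProd α β s

/-- The integrand `Γ(δ - s) ∏ Γ(α_i s + β_i)` that defines `X_{α,β}`. -/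
def kernelX {r : ℕ} (δ : ℝ) (α : Fin r → ℝ) (β : Fin r → ℂ) (s : ℂ) : ℂ :=
  Gamma (δ - s) * gammaProd α β s

/-- `Y_{α,β}(x) = (1 / 2πi) ∫_{c - i∞}^{c + i∞} Γ(s) ∏ Γ(α_i s + β_i) x^{-s} ds`. -/
def Y {r : ℕ} (c : ℝ) (α : Fin r → ℝ) (β : Fin r → ℂ) (x : ℝ) : ℂ :=
  mellinInv c (kernelY α β) x

/-- `X_{α,β}(x) = (1 / 2πi) ∫_{c - i∞}^{c + i∞} Γ(δ - s) ∏ Γ(α_i s + β_i) x^{-s} ds`. -/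
def X {r : ℕ} (δ c : ℝ) (α : Fin r → ℝ) (β : Fin r → ℂ) (x : ℝ) : ℂ :=
  mellinInv c (kernelX δ α β) x

end RieszModular

end

/-! The Riesz-sum identity is strong enough to force the functional equation of `F`, namely that `F
s` equals ω Q^(δ-2s) ∏ Γ(α_i(δ-s) + conj β_i) · ∑ conj(b_n) μ_n^(-(δ-s)) far to the left. Given
this, the two series in the conclusion are the integrals of Γ(s)F(s)x^(-s) along Re s = c and Re s =
δ-c, and the residual term is what the contour shift between them picks up.

To obtain the functional equation, put x = `lam 0 / v` and multiply the Riesz identity by x^(-ρ).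
Its right side becomes a superposition of powers v^(-w), with w on the circle and, after s ↦ δ-s, on
the line Re w = δ-c. The Mellin transform over (0,1] sends v^(-w) to 1/(s-w). Hence for Re s > c the
function λ^s φ(s)Γ(s)/Γ(s+ρ+1), with λ = `lam 0`, is B(s) + L(s), the Cauchy transforms of the
circle and line densities. For v > 1 the Riesz mean is empty, so the Mellin transform over (1,∞)
gives B + L = 0 for Re s < δ-c (`Setting.transform_eq_zero_of_re_small`). The first identity
continues to Re s > δ-c outside a square around the circle (`Setting.transform_eq`). Across Re s =
δ-c, B is continuous while L jumps by 2π times its density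
(`tendsto_cauchyTransform_vertical_jump`). Comparing the two sides gives the functional equation on
that line, and the identity theorem spreads it to a half plane (`Setting.F_eq_dualF`).

The shift needs decay of ΓF in the strip (`Setting.exists_norm_reg_le`), and no convexity principle
is required. Near the left edge the functional equation gives decay through Γ(s). Elsewhere B + L is
bounded at large height, and solving for ΓF leaves the decaying factor Γ(s+ρ+1). The shift itself is
`integral_vertical_sub_eq_circleIntegral`, where the principal part inside the disc is removed by a
Cauchy transform. -/

/-! ### Growth of the Gamma function in vertical strips. -/

theorem norm_Gamma_le_Gamma_re {s : ℂ} (hs : 0 < s.re) : ‖Gamma s‖ ≤ Real.Gamma s.re := by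
  rw [Gamma_eq_integral hs, GammaIntegral, Real.Gamma_eq_integral hs]
  refine (norm_integral_le_integral_norm _).trans (le_of_eq ?_)
  refine setIntegral_congr_fun measurableSet_Ioi fun x hx => ?_
  simp only [norm_mul, norm_cpow_eq_rpow_re_of_pos hx]
  rw [norm_real, Real.norm_of_nonneg (Real.exp_pos _).le, sub_re, one_re]

theorem exists_norm_Gamma_le_of_re_mem {A B : ℝ} (hA : 0 < A) :
    ∃ C, 0 ≤ C ∧ ∀ s : ℂ, A ≤ s.re → s.re ≤ B → ‖Gamma s‖ ≤ C := by
  have hcont : ContinuousOn Real.Gamma (Set.Icc A B) := fun x hx =>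
    (Real.differentiableAt_Gamma fun m h => by
      have : (0 : ℝ) ≤ m := m.cast_nonneg
      linarith [hx.1]).continuousAt.continuousWithinAt
  obtain ⟨C, hC⟩ := isCompact_Icc.exists_bound_of_continuousOn hcont
  refine ⟨|C|, abs_nonneg _, fun s h1 h2 => (norm_Gamma_le_Gamma_re (hA.trans_le h1)).trans ?_⟩
  exact (le_abs_self _).trans ((hC _ ⟨h1, h2⟩).trans (le_abs_self _))

theorem Gamma_add_nat_eq_prod_mul {s : ℂ} (hs : ∀ k : ℕ, s ≠ -k) (n : ℕ) :
    Gamma (s + n) = (∏ j ∈ Finset.range n, (s + j)) * Gamma s := by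
  induction n with
  | zero => simp
  | succ n ih =>
    have h : s + n ≠ 0 := fun h => hs n (by linear_combination h)
    rw [Nat.cast_succ, ← add_assoc, Gamma_add_one _ h, ih, Finset.prod_range_succ]
    ring

theorem ne_neg_nat_of_im_ne_zero {s : ℂ} (hs : s.im ≠ 0) (k : ℕ) : s ≠ -k := by
  rintro rfl
  simp at hs

/-- The Gamma function decays faster than any power of the imaginary part in vertical strips. -/
theorem exists_norm_Gamma_le_div_pow (A B : ℝ) (k : ℕ) :
    ∃ C, 0 ≤ C ∧ ∀ s : ℂ, A ≤ s.re → s.re ≤ B → 1 ≤ |s.im| → ‖Gamma s‖ ≤ C / |s.im| ^ k := by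
  -- A shift by `N` brings the real part to at least 1, where Γ is bounded on strips; `k` further
  -- shifts supply `k` linear factors, each of modulus at least |Im s|.
  obtain ⟨N, hN⟩ := exists_nat_ge (1 - A)
  obtain ⟨C, hC0, hC⟩ := exists_norm_Gamma_le_of_re_mem (A := 1) (B := B + (N + k : ℕ)) one_pos
  refine ⟨C, hC0, fun s h1 h2 h3 => ?_⟩
  have him : s.im ≠ 0 := fun h => by simp [h] at h3; linarith
  have hG := Gamma_add_nat_eq_prod_mul (ne_neg_nat_of_im_ne_zero him) (N + k)
  have hb := hC (s + (N + k : ℕ)) (by simp; have : (0:ℝ) ≤ k := k.cast_nonneg; linarith)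
    (by simp; linarith)
  rw [hG, norm_mul, norm_prod] at hb
  have hp : |s.im| ^ k ≤ ∏ j ∈ Finset.range (N + k), ‖s + j‖ := by
    calc |s.im| ^ k ≤ |s.im| ^ (N + k) := pow_le_pow_right₀ h3 (by omega)
      _ = ∏ _j ∈ Finset.range (N + k), |s.im| := by simp
      _ ≤ _ := Finset.prod_le_prod (fun _ _ => abs_nonneg _) fun j _ => by
        simpa using abs_im_le_norm (s + j)
  rw [le_div_iff₀ (by positivity), mul_comm]
  exact (mul_le_mul_of_nonneg_right hp (norm_nonneg _)).trans hb

namespace RieszModular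

/-! ### The product of Gamma factors. -/

section GammaProd

variable {r : ℕ} {α : Fin r → ℝ} (β : Fin r → ℂ)

/-- Poles may lie in the strip, but only at bounded height: once α_i |Im s| ≥ 1 + |Im β_i| for all
i, every argument has imaginary part of modulus at least 1. -/
theorem exists_norm_gammaProd_le_of_im (hα : ∀ i, 0 < α i) (A B : ℝ) :
    ∃ C T, 0 ≤ C ∧ 1 ≤ T ∧ ∀ s : ℂ, A ≤ s.re → s.re ≤ B → T ≤ |s.im| →
      ‖gammaProd α β s‖ ≤ C := by
  choose C hC0 hC using fun i => exists_norm_Gamma_le_div_pow (α i * A + (β i).re)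
    (α i * B + (β i).re) 0
  obtain ⟨T, hT⟩ := (Set.finite_range fun i => (1 + |(β i).im|) / α i).bddAbove
  refine ⟨∏ i, C i, max 1 T, Finset.prod_nonneg fun i _ => hC0 i, le_max_left _ _,
    fun s h1 h2 h3 => ?_⟩
  rw [gammaProd, norm_prod]
  refine Finset.prod_le_prod (fun _ _ => norm_nonneg _) fun i _ => ?_
  have h4 : (1 + |(β i).im|) / α i ≤ |s.im| :=
    (hT ⟨i, rfl⟩).trans ((le_max_right _ _).trans h3)
  rw [div_le_iff₀ (hα i)] at h4
  have h5 := hC i (α i * s + β i) (by simpa using mul_le_mul_of_nonneg_left h1 (hα i).le)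
    (by simpa using mul_le_mul_of_nonneg_left h2 (hα i).le) (by
      have := abs_sub_abs_le_abs_sub (α i * s.im) (-(β i).im)
      rw [abs_mul, abs_of_pos (hα i), abs_neg, sub_neg_eq_add] at this
      simp
      linarith)
  simpa using h5

theorem gammaProd_ne_zero (hα : ∀ i, 0 < α i) :
    ∃ T, 1 ≤ T ∧ ∀ s : ℂ, T ≤ |s.im| → gammaProd α β s ≠ 0 := by
  obtain ⟨T, hT⟩ := (Set.finite_range fun i => (1 + |(β i).im|) / α i).bddAbove
  refine ⟨max 1 T, le_max_left _ _, fun s h3 => Finset.prod_ne_zero_iff.2 fun i _ => ?_⟩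
  refine Gamma_ne_zero (ne_neg_nat_of_im_ne_zero ?_)
  have h4 : (1 + |(β i).im|) / α i ≤ |s.im| :=
    (hT ⟨i, rfl⟩).trans ((le_max_right _ _).trans h3)
  rw [div_le_iff₀ (hα i)] at h4
  have := abs_sub_abs_le_abs_sub (α i * s.im) (-(β i).im)
  rw [abs_mul, abs_of_pos (hα i), abs_neg, sub_neg_eq_add] at this
  intro h
  simp at h
  rw [h, abs_zero] at this
  linarith

theorem re_gammaProd_arg_pos (hα : ∀ i, 0 < α i) (hβ : ∀ i, 0 ≤ (β i).re) {s : ℂ}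
    (hs : 0 < s.re) (i : Fin r) : 0 < ((α i : ℂ) * s + β i).re := by
  have := mul_pos (hα i) hs
  simp
  linarith [hβ i]

theorem exists_norm_gammaProd_le_of_re (hα : ∀ i, 0 < α i) (hβ : ∀ i, 0 ≤ (β i).re) {A B : ℝ}
    (hA : 0 < A) : ∃ C, 0 ≤ C ∧ ∀ s : ℂ, A ≤ s.re → s.re ≤ B → ‖gammaProd α β s‖ ≤ C := by
  choose C hC0 hC using fun i => exists_norm_Gamma_le_of_re_mem (A := α i * A + (β i).re)
    (B := α i * B + (β i).re) (by have := mul_pos (hα i) hA; linarith [hβ i])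
  refine ⟨∏ i, C i, Finset.prod_nonneg fun i _ => hC0 i, fun s h1 h2 => ?_⟩
  rw [gammaProd, norm_prod]
  exact Finset.prod_le_prod (fun _ _ => norm_nonneg _) fun i _ =>
    hC i _ (by simpa using mul_le_mul_of_nonneg_left h1 (hα i).le)
      (by simpa using mul_le_mul_of_nonneg_left h2 (hα i).le)

theorem gammaProd_ne_zero_of_re_pos (hα : ∀ i, 0 < α i) (hβ : ∀ i, 0 ≤ (β i).re) {s : ℂ}
    (hs : 0 < s.re) : gammaProd α β s ≠ 0 :=
  Finset.prod_ne_zero_iff.2 fun i _ => Gamma_ne_zero_of_re_pos (re_gammaProd_arg_pos β hα hβ hs i)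

theorem differentiableAt_gammaProd (hα : ∀ i, 0 < α i) (hβ : ∀ i, 0 ≤ (β i).re) {s : ℂ}
    (hs : 0 < s.re) : DifferentiableAt ℂ (gammaProd α β) s := by
  unfold gammaProd
  refine DifferentiableAt.fun_finsetProd fun i _ => ?_
  refine DifferentiableAt.comp s (differentiableAt_Gamma _ fun k h => ?_) (by fun_prop)
  have := re_gammaProd_arg_pos β hα hβ hs i
  rw [h] at this
  simp at this
  linarith [(Nat.cast_nonneg k : (0 : ℝ) ≤ k)]

/-- No restriction on `s` is needed: 1/Γ is entire, and at a pole the convention Γ = 0, 0⁻¹ = 0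
yields its true value. -/
theorem differentiable_inv_gammaProd : Differentiable ℂ fun s => (gammaProd α β s)⁻¹ := by
  have : (fun s => (gammaProd α β s)⁻¹) = fun s => ∏ i, (Gamma ((α i : ℂ) * s + β i))⁻¹ := by
    funext s
    simp [gammaProd]
  rw [this]
  exact Differentiable.fun_finsetProd fun i _ =>
    differentiable_one_div_Gamma.comp (by fun_prop : Differentiable ℂ fun s => (α i : ℂ) * s + β i)

end GammaProd

/-! ### General Dirichlet series in their domain of absolute convergence. -/

section DirichletSeries

variable {u : ℕ → ℂ} {ν : ℕ → ℝ} {σ : ℝ}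

theorem IsFrequency.summable_of_le (hν : IsFrequency ν) {τ τ' : ℝ} (h : τ ≤ τ')
    (hs : Summable fun n => ‖u n‖ * ν n ^ (-τ)) : Summable fun n => ‖u n‖ * ν n ^ (-τ') := by
  refine hs.of_norm_bounded_eventually_nat ?_
  filter_upwards [hν.tendsto.eventually_ge_atTop 1] with n hn
  rw [Real.norm_of_nonneg (mul_nonneg (norm_nonneg _) (Real.rpow_nonneg (hν.pos n).le _))]
  exact mul_le_mul_of_nonneg_left (Real.rpow_le_rpow_of_exponent_le hn (by linarith))
    (norm_nonneg _)

theorem IsFrequency.summable_of_abscissa_lt (hν : IsFrequency ν) (h : IsAbscissa u ν σ) {τ : ℝ}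
    (hτ : σ < τ) : Summable fun n => ‖u n‖ * ν n ^ (-τ) := by
  obtain ⟨τ', h1, h2⟩ := (isGLB_lt_iff h).1 hτ
  exact hν.summable_of_le h2.le h1

theorem IsFrequency.norm_term_eq (hν : IsFrequency ν) (n : ℕ) (s : ℂ) :
    ‖u n * (ν n : ℂ) ^ (-s)‖ = ‖u n‖ * ν n ^ (-s.re) := by
  rw [norm_mul, norm_cpow_eq_rpow_re_of_pos (hν.pos n), neg_re]

/-- Locally uniform convergence. Finitely many frequencies may be below 1, where ν^(-t) increases
with t, so the majorant adds the values at both edges of a strip. -/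
theorem IsFrequency.differentiableAt_dirichletSeries (hν : IsFrequency ν) (h : IsAbscissa u ν σ)
    {s : ℂ} (hs : σ < s.re) : DifferentiableAt ℂ (dirichletSeries u ν) s := by
  obtain ⟨τ, h1, h2⟩ := exists_between hs
  have hopen : IsOpen {z : ℂ | τ < z.re ∧ z.re < s.re + 1} :=
    (isOpen_lt continuous_const continuous_re).inter (isOpen_lt continuous_re continuous_const)
  have hS := (hν.summable_of_abscissa_lt h h1).add
    (hν.summable_of_abscissa_lt h (hs.trans (lt_add_one s.re)))
  refine (differentiableOn_tsum_of_summable_norm hS (fun n => ?_) hopen fun n z hz => ?_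
    ).differentiableAt (hopen.mem_nhds (x := s) ⟨h2, by simp⟩)
  · have h0 : (ν n : ℂ) ≠ 0 := by exact_mod_cast (hν.pos n).ne'
    intro z _
    exact (((differentiableAt_id.neg).const_cpow (Or.inl h0)).const_mul _).differentiableWithinAt
  · rw [hν.norm_term_eq, ← mul_add]
    refine mul_le_mul_of_nonneg_left ?_ (norm_nonneg _)
    have hp := Real.rpow_nonneg (hν.pos n).le
    rcases le_total 1 (ν n) with hn | hn
    · have := Real.rpow_le_rpow_of_exponent_le hn (neg_le_neg hz.1.le)
      linarith [hp (-(s.re + 1))]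
    · have := Real.rpow_le_rpow_of_exponent_ge (hν.pos n) hn (neg_le_neg hz.2.le)
      linarith [hp (-τ)]

theorem IsFrequency.exists_norm_dirichletSeries_le (hν : IsFrequency ν) (h : IsAbscissa u ν σ)
    {A B : ℝ} (hA : σ < A) :
    ∃ C, 0 ≤ C ∧ ∀ s : ℂ, A ≤ s.re → s.re ≤ B → ‖dirichletSeries u ν s‖ ≤ C := by
  rcases lt_or_ge B A with hBA | hAB
  · exact ⟨0, le_rfl, fun s h1 h2 => by linarith⟩
  have hS := (hν.summable_of_abscissa_lt h hA).add
    (hν.summable_of_abscissa_lt h (hA.trans_le hAB))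
  refine ⟨_, tsum_nonneg fun n => ?_, fun s h1 h2 => tsum_of_norm_bounded hS.hasSum fun n => ?_⟩
  · have := fun t : ℝ => mul_nonneg (norm_nonneg (u n)) (Real.rpow_nonneg (hν.pos n).le t)
    exact add_nonneg (this _) (this _)
  · rw [hν.norm_term_eq, ← mul_add]
    refine mul_le_mul_of_nonneg_left ?_ (norm_nonneg _)
    have hp := Real.rpow_nonneg (hν.pos n).le
    rcases le_total 1 (ν n) with hn | hn
    · have := Real.rpow_le_rpow_of_exponent_le hn (neg_le_neg h1)
      linarith [hp (-B)]
    · have := Real.rpow_le_rpow_of_exponent_ge (hν.pos n) hn (neg_le_neg h2)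
      linarith [hp (-A)]

theorem IsAbscissa.conj (h : IsAbscissa u ν σ) : IsAbscissa (fun n => conj (u n)) ν σ := by
  simpa [IsAbscissa] using h

/-- Termwise inverse Mellin transformation of a Dirichlet series. -/
theorem IsFrequency.hasSum_mellinInv (hν : IsFrequency ν) {c : ℝ}
    (hs : Summable fun n => ‖u n‖ * ν n ^ (-c)) {f : ℂ → ℂ} (hf : VerticalIntegrable f c)
    {y : ℝ} (hy : 0 < y) :
    Summable (fun n => u n * mellinInv c f (ν n * y)) ∧
    ∑' n, u n * mellinInv c f (ν n * y) =
      mellinInv c (fun s => f s * dirichletSeries u ν s) y := by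
  let G : ℕ → ℝ → ℂ := fun n t =>
    u n * ((((ν n * y : ℝ) : ℂ) ^ (-((c : ℂ) + t * I))) * f (c + t * I))
  have hf' : Integrable fun t : ℝ => f (c + t * I) := hf
  -- On a vertical line |ν^(-s)| does not depend on t, so the norm splits into a function of n times
  -- a function of t; this justifies exchanging sum and integral.
  have hnorm : ∀ n t, ‖G n t‖ = ‖u n‖ * ν n ^ (-c) * (y ^ (-c) * ‖f (c + t * I)‖) := by
    intro n t
    simp only [G, norm_mul, norm_cpow_eq_rpow_re_of_pos (mul_pos (hν.pos n) hy)]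
    simp [Real.mul_rpow (hν.pos n).le hy.le]
    ring
  have hint : ∀ n, Integrable (G n) := by
    intro n
    have h0 : ((ν n * y : ℝ) : ℂ) ≠ 0 := by exact_mod_cast (mul_pos (hν.pos n) hy).ne'
    refine Integrable.mono (hf'.norm.const_mul (‖u n‖ * ν n ^ (-c) * y ^ (-c))) ?_ ?_
    · refine (AEStronglyMeasurable.mul ?_ hf'.aestronglyMeasurable).const_mul _
      refine Continuous.aestronglyMeasurable ?_
      exact Continuous.const_cpow (by fun_prop) (Or.inl h0)
    · refine Eventually.of_forall fun t => ?_
      rw [hnorm, Real.norm_of_nonneg]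
      · simp only [mul_assoc, le_refl]
      · have := Real.rpow_nonneg (hν.pos n).le (-c)
        have := Real.rpow_nonneg hy.le (-c)
        positivity
  have hsum : Summable fun n => ∫ t, ‖G n t‖ := by
    simp only [hnorm, integral_const_mul]
    exact hs.mul_right _
  have hH := hasSum_integral_of_summable_integral_norm hint hsum
  have h1 : ∀ n, u n * mellinInv c f (ν n * y) = (1 / (2 * Real.pi)) • ∫ t, G n t := by
    intro n
    simp only [G, mellinInv, integral_const_mul, smul_eq_mul]
    rw [mul_smul_comm]
  have h2 : mellinInv c (fun s => f s * dirichletSeries u ν s) y =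
      (1 / (2 * Real.pi)) • ∫ t, ∑' n, G n t := by
    rw [mellinInv]
    congr 2
    funext t
    simp only [G, dirichletSeries, smul_eq_mul]
    rw [← mul_assoc, ← tsum_mul_left]
    congr 1
    funext n
    rw [ofReal_mul, mul_cpow_ofReal_nonneg (hν.pos n).le hy.le]
    ring
  have h3 := hH.const_smul (1 / (2 * Real.pi))
  simp only [h1, h2]
  exact ⟨h3.summable, h3.tsum_eq⟩

end DirichletSeries

end RieszModular

theorem integrable_of_norm_le_div_sq {f : ℝ → ℂ} (hf : Continuous f) {C T : ℝ}
    (h : ∀ t, T ≤ |t| → ‖f t‖ ≤ C / |t| ^ 2) : Integrable f := by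
  have hO : ∀ l : Filter ℝ, Tendsto (fun t : ℝ => |t|) l atTop →
      f =O[l] fun t : ℝ => (1 + t ^ 2)⁻¹ := by
    intro l hl
    refine Asymptotics.IsBigO.of_bound (2 * |C|) ?_
    filter_upwards [hl.eventually_ge_atTop T, hl.eventually_ge_atTop 1] with t h1 h2
    refine (h t h1).trans ?_
    rw [norm_inv, Real.norm_of_nonneg (by positivity), ← sq_abs t, ← div_eq_mul_inv,
      div_le_div_iff₀ (by positivity) (by positivity)]
    have h3 : 1 ≤ |t| ^ 2 := one_le_pow₀ h2
    nlinarith [le_abs_self C, abs_nonneg C]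
  exact hf.locallyIntegrable.integrable_of_isBigO_atBot_atTop
    (hO _ tendsto_abs_atBot_atTop) (integrable_inv_one_add_sq.integrableAtFilter _)
    (hO _ tendsto_abs_atTop_atTop) (integrable_inv_one_add_sq.integrableAtFilter _)

/-! ### Cauchy transforms along parametrised curves. -/

noncomputable section CauchyTransform

variable {Ω : Type*} [MeasurableSpace Ω] {μ : Measure Ω} {f w : Ω → ℂ} {s₀ : ℂ} {d : ℝ}

/-- The Cauchy transform `s ↦ ∫ f / (s - w) dμ` along a parametrised curve `w`. -/
def cauchyTransform (μ : Measure Ω) (f w : Ω → ℂ) (s : ℂ) : ℂ :=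
  ∫ θ, f θ / (s - w θ) ∂μ

theorem integrable_div_sub (hf : Integrable f μ) (hw : Measurable w) (hd : 0 < d)
    (h : ∀ θ, d ≤ ‖s₀ - w θ‖) : Integrable (fun θ => f θ / (s₀ - w θ)) μ := by
  refine Integrable.mono' (hf.norm.mul_const d⁻¹)
    (by
      simp only [div_eq_mul_inv]
      exact hf.aestronglyMeasurable.mul (measurable_const.sub hw).inv.aestronglyMeasurable)
    (Eventually.of_forall fun θ => ?_)
  rw [norm_div, div_eq_mul_inv]
  exact mul_le_mul_of_nonneg_left (inv_anti₀ hd (h θ)) (norm_nonneg _)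

theorem norm_cauchyTransform_le (hf : Integrable f μ) (hd : 0 < d) (h : ∀ θ, d ≤ ‖s₀ - w θ‖) :
    ‖cauchyTransform μ f w s₀‖ ≤ (∫ θ, ‖f θ‖ ∂μ) / d := by
  rw [div_eq_mul_inv, ← integral_mul_const]
  refine norm_integral_le_of_norm_le (hf.norm.mul_const _) (Eventually.of_forall fun θ => ?_)
  rw [norm_div, div_eq_mul_inv]
  exact mul_le_mul_of_nonneg_left (inv_anti₀ hd (h θ)) (norm_nonneg _)

/-- Differentiation under the integral: points within d/2 of `s₀` stay at distance at least d/2 from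
the curve, so ‖f‖ (d/2)^(-2) dominates the derivative. -/
theorem differentiableAt_cauchyTransform (hf : Integrable f μ) (hw : Measurable w) (hd : 0 < d)
    (h : ∀ θ, d ≤ ‖s₀ - w θ‖) : DifferentiableAt ℂ (cauchyTransform μ f w) s₀ := by
  have hfar : ∀ s ∈ Metric.ball s₀ (d / 2), ∀ θ, d / 2 ≤ ‖s - w θ‖ := by
    intro s hs θ
    have h1 := norm_sub_le_norm_sub_add_norm_sub s₀ s (w θ)
    rw [Metric.mem_ball, dist_comm, dist_eq_norm] at hs
    linarith [h θ]
  have hd2 := half_pos hd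
  refine (hasDerivAt_integral_of_dominated_loc_of_deriv_le (F' := fun s θ => -f θ / (s - w θ) ^ 2)
    (bound := fun θ => ‖f θ‖ * ((d / 2) ^ 2)⁻¹) (Metric.ball_mem_nhds s₀ hd2)
    (Eventually.of_forall fun s => ?_) (integrable_div_sub hf hw hd h) ?_
    (Eventually.of_forall fun θ s hs => ?_) (hf.norm.mul_const _)
    (Eventually.of_forall fun θ s hs => ?_)).2.differentiableAt
  · simp only [div_eq_mul_inv]
    exact hf.aestronglyMeasurable.mul (measurable_const.sub hw).inv.aestronglyMeasurable
  · simp only [div_eq_mul_inv]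
    exact hf.aestronglyMeasurable.neg.mul
      ((measurable_const.sub hw).pow_const 2).inv.aestronglyMeasurable
  · rw [norm_div, norm_neg, norm_pow, div_eq_mul_inv]
    exact mul_le_mul_of_nonneg_left
      (inv_anti₀ (by positivity) (pow_le_pow_left₀ hd2.le (hfar s hs θ) 2)) (norm_nonneg _)
  · have hne : s - w θ ≠ 0 := norm_pos_iff.1 (hd2.trans_le (hfar s hs θ))
    convert! (hasDerivAt_const s (f θ)).div ((hasDerivAt_id s).sub_const (w θ)) hne using 1
    simp

end CauchyTransform

/-! ### Cauchy transforms over circles and removal of principal parts. -/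

noncomputable section CircleTransform

/-- The density of the circle integral of `g` with respect to the angle. -/
def circleDensity (g : ℂ → ℂ) (z₀ : ℂ) (R : ℝ) (θ : ℝ) : ℂ :=
  deriv (circleMap z₀ R) θ * g (circleMap z₀ R θ)

/-- The angular measure on `(0, 2π]`. -/
abbrev angleMeasure : Measure ℝ := volume.restrict (Set.Ioc 0 (2 * Real.pi))

theorem circleIntegral_eq_integral_angle (g : ℂ → ℂ) (z₀ : ℂ) (R : ℝ) :
    (∮ z in C(z₀, R), g z) = ∫ θ, circleDensity g z₀ R θ ∂angleMeasure := by
  rw [circleIntegral, intervalIntegral.integral_of_le Real.two_pi_pos.le]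
  rfl

theorem integrable_circleDensity {g : ℂ → ℂ} {z₀ : ℂ} {R : ℝ} (hR : 0 ≤ R)
    (hg : ContinuousOn g (Metric.sphere z₀ R)) :
    Integrable (circleDensity g z₀ R) angleMeasure := by
  have := (hg.circleIntegrable hR).out
  rwa [intervalIntegrable_iff_integrableOn_Ioc_of_le Real.two_pi_pos.le] at this

theorem circleIntegral_div_sub_eq_cauchyTransform (g : ℂ → ℂ) (z₀ : ℂ) (R : ℝ) (s : ℂ) :
    (∮ z in C(z₀, R), g z / (s - z)) =
      cauchyTransform angleMeasure (circleDensity g z₀ R) (circleMap z₀ R) s := by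
  rw [circleIntegral_eq_integral_angle]
  simp only [cauchyTransform, circleDensity, mul_div_assoc]

theorem sub_le_norm_sub_circleMap {z₀ : ℂ} {R : ℝ} (hR : 0 ≤ R) (s : ℂ) (θ : ℝ) :
    ‖s - z₀‖ - R ≤ ‖s - circleMap z₀ R θ‖ := by
  have h1 := norm_sub_le_norm_sub_add_norm_sub s (circleMap z₀ R θ) z₀
  have h2 : ‖circleMap z₀ R θ - z₀‖ = R := by simp [abs_of_nonneg hR]
  linarith

theorem differentiableAt_cauchyTransform_circle {g : ℂ → ℂ} {z₀ : ℂ} {R : ℝ} (hR : 0 ≤ R)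
    (hg : ContinuousOn g (Metric.sphere z₀ R)) {s : ℂ} (hs : s ∉ Metric.closedBall z₀ R) :
    DifferentiableAt ℂ
      (cauchyTransform angleMeasure (circleDensity g z₀ R) (circleMap z₀ R)) s := by
  rw [Metric.mem_closedBall, dist_eq_norm, not_le] at hs
  exact differentiableAt_cauchyTransform (integrable_circleDensity hR hg)
    (measurable_circleMap z₀ R) (sub_pos.2 hs) (sub_le_norm_sub_circleMap hR s)

/-- The principal part of a function that is analytic in an annulus: subtracting the Cauchy
transform over the inner circle leaves a function that extends analytically inside. -/
theorem exists_differentiableAt_ball_eq_sub_cauchyTransform {g : ℂ → ℂ} {z₀ : ℂ} {R R' : ℝ}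
    (hR : 0 < R) (hR' : R < R')
    (hg : ∀ s ∈ Metric.closedBall z₀ R', s ∉ Metric.ball z₀ R → DifferentiableAt ℂ g s) :
    ∃ h : ℂ → ℂ, (∀ s ∈ Metric.ball z₀ R', DifferentiableAt ℂ h s) ∧
      ∀ s ∈ Metric.ball z₀ R', s ∉ Metric.closedBall z₀ R →
        h s = g s - (2 * Real.pi * I : ℂ)⁻¹ *
          cauchyTransform angleMeasure (circleDensity g z₀ R) (circleMap z₀ R) s := by
  have hR0 : 0 < R' := hR.trans hR'
  have hsphere : ∀ r, R ≤ r → r ≤ R' → ContinuousOn g (Metric.sphere z₀ r) := by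
    intro r h1 h2 z hz
    rw [mem_sphere_iff_norm] at hz
    exact (hg z (by rw [mem_closedBall_iff_norm]; linarith)
      (by rw [mem_ball_iff_norm]; linarith)).continuousAt.continuousWithinAt
  -- The extension is the Cauchy integral over the outer circle, which is holomorphic throughout the
  -- larger disc.
  refine ⟨fun s => (2 * Real.pi * I : ℂ)⁻¹ • ∮ z in C(z₀, R'), (z - s)⁻¹ • g z, fun s hs => ?_,
    fun s hs hs' => ?_⟩
  · lift R' to NNReal using hR0.le
    have hps := hasFPowerSeriesOn_cauchy_integral (f := g) (c := z₀) (R := R')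
      ((hsphere _ hR'.le le_rfl).circleIntegrable hR0.le) (by exact_mod_cast hR0)
    refine hps.differentiableOn.differentiableAt (Metric.isOpen_eball.mem_nhds ?_)
    rwa [Metric.eball_coe]
  · have hs1 := hs
    have hs2 := hs'
    rw [mem_ball_iff_norm] at hs1
    rw [mem_closedBall_iff_norm, not_le] at hs2
    have hdiff : ∀ z ∈ Metric.closedBall z₀ R', z ∉ Metric.ball z₀ R → z ≠ s →
        DifferentiableAt ℂ (dslope g s) z := fun z h1 h2 h3 =>
      (differentiableAt_dslope_of_ne h3).2 (hg z h1 h2)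
    have hgs : DifferentiableAt ℂ g s := hg s (Metric.ball_subset_closedBall hs)
      fun h => hs' (Metric.ball_subset_closedBall h)
    have hcont : ContinuousOn (dslope g s) (Metric.closedBall z₀ R' \ Metric.ball z₀ R) := by
      rintro z ⟨h1, h2⟩
      rcases eq_or_ne z s with rfl | h3
      · exact (continuousAt_dslope_same.2 hgs).continuousWithinAt
      · exact (hdiff z h1 h2 h3).continuousAt.continuousWithinAt
    -- The difference quotient of `g` at `s` has no singularity in the annulus, so its integrals
    -- over both circles agree. What remains is g(s) ∮ (z-s)⁻¹, equal to 2πi g(s) on the outer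
    -- circle and 0 on the inner one.
    have key := circleIntegral_eq_of_differentiable_on_annulus_off_countable hR hR'.le
      (Set.countable_singleton s) hcont fun z hz => hdiff z (Metric.ball_subset_closedBall hz.1.1)
        (fun h => hz.1.2 (Metric.ball_subset_closedBall h)) (by simpa using hz.2)
    have hsplit : ∀ r, R ≤ r → r ≤ R' → ‖s - z₀‖ ≠ r →
        (∮ z in C(z₀, r), (z - s)⁻¹ • g z) =
          (∮ z in C(z₀, r), dslope g s z) + g s * ∮ z in C(z₀, r), (z - s)⁻¹ := by
      intro r h1 h2 h3
      have hr : 0 ≤ r := hR.le.trans h1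
      have hne : ∀ z ∈ Metric.sphere z₀ r, z ≠ s := by
        rintro z hz rfl
        exact h3 (mem_sphere_iff_norm.1 hz)
      have hinv : ContinuousOn (fun z => (z - s)⁻¹) (Metric.sphere z₀ r) :=
        ContinuousOn.inv₀ (by fun_prop) fun z hz => sub_ne_zero.2 (hne z hz)
      have hds : ContinuousOn (dslope g s) (Metric.sphere z₀ r) := hcont.mono fun z hz => by
        rw [mem_sphere_iff_norm] at hz
        exact ⟨by rw [mem_closedBall_iff_norm]; linarith, by rw [mem_ball_iff_norm]; linarith⟩
      have h4 : (∮ z in C(z₀, r), g s * (z - s)⁻¹) = g s * ∮ z in C(z₀, r), (z - s)⁻¹ := by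
        simpa only using circleIntegral.integral_const_mul (g s) (fun z => (z - s)⁻¹) z₀ r
      rw [← h4, ← circleIntegral.integral_add (g := fun z => g s * (z - s)⁻¹)
        (hds.circleIntegrable hr) ((continuousOn_const.mul hinv).circleIntegrable hr)]
      refine circleIntegral.integral_congr hr fun z hz => ?_
      have := sub_ne_zero.2 (hne z hz)
      simp only [dslope_of_ne _ (hne z hz), slope_def_field, smul_eq_mul]
      field_simp
      ring
    have h1 := hsplit R' hR'.le le_rfl hs1.ne
    have h2 := hsplit R le_rfl hR'.le hs2.ne'
    rw [circleIntegral.integral_sub_inv_of_mem_ball hs] at h1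
    have h3 : (∮ z in C(z₀, R), (z - s)⁻¹) = 0 := by
      refine circleIntegral_eq_zero_of_differentiable_on_off_countable hR.le Set.countable_empty
        (ContinuousOn.inv₀ (by fun_prop) fun z hz => sub_ne_zero.2 ?_) fun z hz => ?_
      · rintro rfl
        exact hs' hz
      · refine DifferentiableAt.fun_inv (by fun_prop) (sub_ne_zero.2 ?_)
        rintro rfl
        exact hs' (Metric.ball_subset_closedBall hz.1)
    have h4 : (∮ z in C(z₀, R), g z / (s - z)) = -∮ z in C(z₀, R), (z - s)⁻¹ • g z := by
      simp only [circleIntegral_eq_integral_angle, ← integral_neg]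
      congr 1
      funext θ
      simp only [circleDensity, smul_eq_mul]
      rw [← neg_sub (circleMap z₀ R θ) s, div_neg]
      ring
    rw [← circleIntegral_div_sub_eq_cauchyTransform, h4, h2, h3, ← key]
    beta_reduce
    rw [h1, smul_eq_mul]
    have hpi : (2 * Real.pi * I : ℂ) ≠ 0 := two_pi_I_ne_zero
    field_simp
    ring

end CircleTransform

/-! ### Integrals of simple poles along vertical lines. -/

section VerticalLines

open Topology

/-- Factoring t out of both arguments cancels log t and leaves log I - log(-I) in the limit. -/
theorem tendsto_log_sub_log_atTop {p q : ℝ} :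
    Tendsto (fun t : ℝ => log (p + t * I) - log (q - t * I)) atTop (𝓝 (Real.pi * I)) := by
  have h1 : ∀ p : ℝ, Tendsto (fun t : ℝ => ((p / t : ℝ) : ℂ)) atTop (𝓝 0) := fun p => by
    have := tendsto_const_nhds (x := p).div_atTop (tendsto_id (α := ℝ) (x := atTop))
    exact (continuous_ofReal.tendsto' 0 0 ofReal_zero).comp this
  have h2 : Tendsto (fun t : ℝ => log ((p / t : ℝ) + I) - log ((q / t : ℝ) - I)) atTop
      (𝓝 (log (0 + I) - log (0 - I))) := by
    refine Tendsto.sub (Tendsto.clog ((h1 p).add_const I) ?_) (Tendsto.clog ((h1 q).sub_const I) ?_)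
      <;> simp [slitPlane]
  have h3 : log (0 + I) - log (0 - I) = Real.pi * I := by
    rw [zero_add, zero_sub, log_I, log_neg_I]
    ring
  rw [h3] at h2
  refine h2.congr' ?_
  filter_upwards [eventually_gt_atTop 0] with t ht
  have ht' : (t : ℂ) ≠ 0 := by exact_mod_cast ht.ne'
  have e1 : (p + t * I : ℂ) = (t : ℂ) * ((p / t : ℝ) + I) := by
    push_cast
    field_simp
  have e2 : (q - t * I : ℂ) = (t : ℂ) * ((q / t : ℝ) - I) := by
    push_cast
    field_simp
  have n1 : ((p / t : ℝ) + I : ℂ) ≠ 0 := fun h => by simpa using congrArg im h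
  have n2 : ((q / t : ℝ) - I : ℂ) ≠ 0 := fun h => by simpa using congrArg im h
  rw [e1, e2, log_ofReal_mul ht n1, log_ofReal_mul ht n2]
  ring

theorem integral_inv_add_inv {p q : ℝ} (hp : 0 < p) (hq : 0 < q)
    (hint : Integrable fun t : ℝ => (p + t * I : ℂ)⁻¹ + (q - t * I : ℂ)⁻¹) :
    ∫ t : ℝ, ((p + t * I : ℂ)⁻¹ + (q - t * I : ℂ)⁻¹) = 2 * Real.pi := by
  have hderiv : ∀ t : ℝ, HasDerivAt (fun t : ℝ => -I * (log (p + t * I) - log (q - t * I)))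
      ((p + t * I : ℂ)⁻¹ + (q - t * I : ℂ)⁻¹) t := by
    intro t
    have a1 : HasDerivAt (fun t : ℝ => (p + t * I : ℂ)) I t := by
      simpa using (((hasDerivAt_id t).ofReal_comp).mul_const I).const_add (p : ℂ)
    have a2 : HasDerivAt (fun t : ℝ => (q - t * I : ℂ)) (-I) t := by
      simpa using (((hasDerivAt_id t).ofReal_comp).mul_const I).const_sub (q : ℂ)
    have := ((a1.clog_real (by simp [slitPlane, hp])).sub
      (a2.clog_real (by simp [slitPlane, hq]))).const_mul (-I)
    convert! this using 1
    rw [mul_sub, mul_div_assoc', mul_div_assoc', neg_mul, I_mul_I, neg_mul, mul_neg, I_mul_I]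
    simp only [neg_neg, div_eq_mul_inv]
    ring
  have htop := (tendsto_log_sub_log_atTop (p := p) (q := q)).const_mul (-I)
  have hbot : Tendsto (fun t : ℝ => -I * (log (p + t * I) - log (q - t * I))) atBot
      (𝓝 (I * (Real.pi * I))) := by
    have := ((tendsto_log_sub_log_atTop (p := q) (q := p)).const_mul I).comp
      tendsto_neg_atBot_atTop
    refine this.congr fun t => ?_
    simp only [Function.comp, ofReal_neg, neg_mul, sub_neg_eq_add, ← sub_eq_add_neg]
    ring
  rw [integral_of_hasDerivAt_of_tendsto hderiv hint hbot htop]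
  linear_combination (-2 * Real.pi : ℂ) * I_mul_I

/-- A single pole term decays only like 1/|t|, but the difference between two lines is (a-b) over a
product, hence O(1/t²). Uniformity in `w` provides the majorant for Fubini over the circle. -/
theorem exists_norm_inv_sub_inv_vertical_le (a b : ℝ) (z₀ : ℂ) (R : ℝ) {e : ℝ} (he : 0 < e) :
    ∃ C, ∀ w : ℂ, ‖w - z₀‖ ≤ R → a + e ≤ w.re → w.re + e ≤ b → ∀ t : ℝ,
      ‖(b + t * I - w : ℂ)⁻¹ - (a + t * I - w : ℂ)⁻¹‖ ≤ C * (1 + t ^ 2)⁻¹ := by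
  set M := |z₀.im| + R with hM
  refine ⟨|b - a| * ((1 + 2 * M ^ 2) / e ^ 2 + 2), fun w hw ha hb t => ?_⟩
  have hv : |w.im| ≤ M := by
    have h1 := (abs_im_le_norm (w - z₀)).trans hw
    have h2 := abs_sub_abs_le_abs_sub w.im z₀.im
    rw [sub_im] at h1
    linarith
  have hlow : ∀ x : ℝ, e ≤ |x - w.re| →
      e ^ 2 + (t - w.im) ^ 2 ≤ ‖(x + t * I - w : ℂ)‖ ^ 2 := by
    intro x hx
    rw [← normSq_eq_norm_sq, normSq_apply]
    simp only [sub_re, add_re, ofReal_re, mul_re, I_re, mul_zero, ofReal_im, I_im, mul_one,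
      sub_self, add_zero, sub_im, add_im, mul_im, zero_add]
    nlinarith [sq_abs (x - w.re)]
  have hB := hlow b (by rw [abs_of_nonneg] <;> linarith)
  have hA := hlow a (by rw [abs_of_nonpos] <;> linarith)
  have hpos : 0 < e ^ 2 + (t - w.im) ^ 2 := by positivity
  have hB0 : (b + t * I - w : ℂ) ≠ 0 := by
    intro h
    rw [h] at hB
    simp at hB
    linarith
  have hA0 : (a + t * I - w : ℂ) ≠ 0 := by
    intro h
    rw [h] at hA
    simp at hA
    linarith
  have hprod : e ^ 2 + (t - w.im) ^ 2 ≤ ‖(b + t * I - w : ℂ)‖ * ‖(a + t * I - w : ℂ)‖ :=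
    (sq_le_sq₀ (by positivity) (by positivity)).1 (by
      rw [mul_pow]
      calc (e ^ 2 + (t - w.im) ^ 2) ^ 2 = (e ^ 2 + (t - w.im) ^ 2) * (e ^ 2 + (t - w.im) ^ 2) :=
            sq _
        _ ≤ _ := mul_le_mul hB hA hpos.le (by positivity))
  -- From t² ≤ 2(t - Im w)² + 2(Im w)²: the quotient by e² absorbs 1 + 2M², the summand 2 absorbs
  -- the rest.
  have hcmp : 1 + t ^ 2 ≤ ((1 + 2 * M ^ 2) / e ^ 2 + 2) * (e ^ 2 + (t - w.im) ^ 2) := by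
    have h1 : w.im ^ 2 ≤ M ^ 2 := sq_le_sq' (by linarith [neg_abs_le w.im])
      (by linarith [le_abs_self w.im])
    have h2 : (1 + 2 * M ^ 2) / e ^ 2 * e ^ 2 = 1 + 2 * M ^ 2 := by
      field_simp
    have h3 : 0 ≤ (1 + 2 * M ^ 2) / e ^ 2 * (t - w.im) ^ 2 := by positivity
    nlinarith [sq_nonneg (t - 2 * w.im), sq_nonneg e]
  rw [inv_sub_inv hB0 hA0, norm_div, norm_mul,
    show (a + t * I - w - (b + t * I - w) : ℂ) = ((-(b - a) : ℝ) : ℂ) by push_cast; ring,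
    norm_real, Real.norm_eq_abs, abs_neg, mul_assoc, div_eq_mul_inv]
  refine mul_le_mul_of_nonneg_left ?_ (abs_nonneg _)
  rw [← div_eq_mul_inv, inv_eq_one_div, div_le_div_iff₀ (hpos.trans_le hprod) (by positivity),
    one_mul]
  exact hcmp.trans (mul_le_mul_of_nonneg_left hprod (by positivity))

/-- The residue theorem for one simple pole between two lines; translating by Im w reduces it to the
explicit logarithmic primitive. -/
theorem integral_inv_sub_inv_vertical {a b : ℝ} {w : ℂ} (ha : a < w.re) (hb : w.re < b) :
    ∫ t : ℝ, ((b + t * I - w : ℂ)⁻¹ - (a + t * I - w : ℂ)⁻¹) = 2 * Real.pi := by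
  obtain ⟨C, hC⟩ := exists_norm_inv_sub_inv_vertical_le a b w 0
    (e := min (w.re - a) (b - w.re)) (lt_min (sub_pos.2 ha) (sub_pos.2 hb))
  have hcont : ∀ x : ℝ, x ≠ w.re → Continuous fun t : ℝ => (x + t * I - w : ℂ)⁻¹ := by
    intro x hx
    refine Continuous.inv₀ (by fun_prop) fun t h => hx ?_
    have := congrArg re h
    simp at this
    linarith
  have hint : Integrable fun t : ℝ => (b + t * I - w : ℂ)⁻¹ - (a + t * I - w : ℂ)⁻¹ :=
    (integrable_inv_one_add_sq.const_mul C).mono'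
      ((hcont b hb.ne').sub (hcont a ha.ne)).aestronglyMeasurable
      (Eventually.of_forall fun t => hC w (by simp) (by linarith [min_le_left (w.re - a) (b - w.re)])
        (by linarith [min_le_right (w.re - a) (b - w.re)]) t)
  have hshift : ∀ t : ℝ, (((b - w.re : ℝ) : ℂ) + t * I)⁻¹ + (((w.re - a : ℝ) : ℂ) - t * I)⁻¹ =
      (b + (t + w.im : ℝ) * I - w : ℂ)⁻¹ - (a + (t + w.im : ℝ) * I - w : ℂ)⁻¹ := by
    intro t
    rw [sub_eq_add_neg (b + (t + w.im : ℝ) * I - w : ℂ)⁻¹, ← inv_neg]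
    congr 2
    · push_cast
      linear_combination -(re_add_im w)
    · push_cast
      linear_combination re_add_im w
  have h1 := integral_inv_add_inv (sub_pos.2 hb) (sub_pos.2 ha) (by
    simp only [hshift]
    exact hint.comp_add_right w.im)
  simp only [hshift] at h1
  rwa [integral_add_right_eq_self
    (fun t : ℝ => (b + t * I - w : ℂ)⁻¹ - (a + t * I - w : ℂ)⁻¹) w.im] at h1

end VerticalLines

/-! ### Shifting a vertical line of integration across a disc. -/

section ContourShift

open Topology

variable {g : ℂ → ℂ} {a b R T C : ℝ} {z₀ : ℂ}

theorem re_add_radius_lt_of_closedBall_subset (hR : 0 < R)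
    (h : Metric.closedBall z₀ R ⊆ {s : ℂ | a < s.re ∧ s.re < b}) :
    a < z₀.re - R ∧ z₀.re + R < b := by
  have h1 := h (show z₀ - R ∈ Metric.closedBall z₀ R by simp [abs_of_pos hR])
  have h2 := h (show z₀ + R ∈ Metric.closedBall z₀ R by simp [abs_of_pos hR])
  exact ⟨by simpa using h1.1, by simpa using h2.2⟩

theorem abs_re_sub_le_norm (s z : ℂ) : |s.re - z.re| ≤ ‖s - z‖ := by
  simpa using abs_re_le_norm (s - z)

theorem abs_im_sub_le_norm (s z : ℂ) : |s.im - z.im| ≤ ‖s - z‖ := by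
  simpa using abs_im_le_norm (s - z)

/-- The two vertical line integrals of the Cauchy transform over a circle between the lines differ
by the circle integral of the density. -/
theorem integral_cauchyTransform_vertical_sub (hR : 0 < R) (ha : a < z₀.re - R)
    (hb : z₀.re + R < b) (hg : ContinuousOn g (Metric.sphere z₀ R)) :
    Integrable (fun t : ℝ =>
      cauchyTransform angleMeasure (circleDensity g z₀ R) (circleMap z₀ R) (b + t * I) -
      cauchyTransform angleMeasure (circleDensity g z₀ R) (circleMap z₀ R) (a + t * I)) ∧
    ∫ t : ℝ, (cauchyTransform angleMeasure (circleDensity g z₀ R) (circleMap z₀ R) (b + t * I) -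
      cauchyTransform angleMeasure (circleDensity g z₀ R) (circleMap z₀ R) (a + t * I)) =
      2 * Real.pi * ∮ z in C(z₀, R), g z := by
  set f := circleDensity g z₀ R
  set w := circleMap z₀ R with hw
  have hf : Integrable f angleMeasure := integrable_circleDensity hR.le hg
  have hwm : Measurable w := (continuous_circleMap z₀ R).measurable
  obtain ⟨e, he, hae, hbe⟩ : ∃ e, 0 < e ∧ a + e ≤ z₀.re - R ∧ z₀.re + R + e ≤ b :=
    ⟨min (z₀.re - R - a) (b - (z₀.re + R)), lt_min (by linarith) (by linarith),
      by linarith [min_le_left (z₀.re - R - a) (b - (z₀.re + R))],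
      by linarith [min_le_right (z₀.re - R - a) (b - (z₀.re + R))]⟩
  have hwR : ∀ θ, ‖w θ - z₀‖ = R := fun θ => by simp [hw, abs_of_pos hR]
  have hwre : ∀ θ, a + e ≤ (w θ).re ∧ (w θ).re + e ≤ b := fun θ => by
    have := abs_le.1 ((abs_re_sub_le_norm (w θ) z₀).trans (hwR θ).le)
    exact ⟨by linarith, by linarith⟩
  have hdist : ∀ x : ℝ, (∀ θ, e ≤ |x - (w θ).re|) → ∀ (t : ℝ) θ, e ≤ ‖(x + t * I : ℂ) - w θ‖ := by
    intro x hx t θ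
    refine (hx θ).trans ?_
    simpa using abs_re_sub_le_norm (x + t * I) (w θ)
  have hdb := hdist b fun θ => by rw [abs_of_nonneg] <;> linarith [hwre θ]
  have hda := hdist a fun θ => by rw [abs_of_nonpos] <;> linarith [hwre θ]
  have hG : ∀ t : ℝ, cauchyTransform angleMeasure f w (b + t * I) -
      cauchyTransform angleMeasure f w (a + t * I) =
      ∫ θ, f θ * ((b + t * I - w θ : ℂ)⁻¹ - (a + t * I - w θ : ℂ)⁻¹) ∂angleMeasure := by
    intro t
    rw [cauchyTransform, cauchyTransform,
      ← integral_sub (integrable_div_sub hf hwm he (hdb t)) (integrable_div_sub hf hwm he (hda t))]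
    simp only [div_eq_mul_inv, mul_sub]
  obtain ⟨C, hC⟩ := exists_norm_inv_sub_inv_vertical_le a b z₀ R he
  have hprod : Integrable (Function.uncurry fun (t θ : ℝ) =>
      f θ * ((b + t * I - w θ : ℂ)⁻¹ - (a + t * I - w θ : ℂ)⁻¹)) (volume.prod angleMeasure) := by
    refine Integrable.mono' ((integrable_inv_one_add_sq.const_mul C).mul_prod hf.norm) ?_
      (Eventually.of_forall fun p => ?_)
    · refine (hf.aestronglyMeasurable.comp_snd).mul (Measurable.aestronglyMeasurable ?_)
      have h1 : Measurable fun p : ℝ × ℝ => w p.2 := hwm.comp measurable_snd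
      have h2 : Measurable fun p : ℝ × ℝ => (p.1 : ℂ) := measurable_ofReal.comp measurable_fst
      exact (((h2.mul_const I).const_add _).sub h1).inv.sub
        (((h2.mul_const I).const_add _).sub h1).inv
    · simp only [Function.uncurry, norm_mul]
      rw [mul_comm]
      exact mul_le_mul_of_nonneg_right (hC _ (hwR _).le (hwre _).1 (hwre _).2 _) (norm_nonneg _)
  simp only [hG]
  refine ⟨hprod.integral_prod_left, ?_⟩
  rw [integral_integral_swap hprod, circleIntegral_eq_integral_angle, ← integral_const_mul]
  congr 1
  funext θ
  rw [integral_const_mul, integral_inv_sub_inv_vertical (by linarith [(hwre θ).1])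
    (by linarith [(hwre θ).2])]
  ring

theorem tendsto_intervalIntegral_horizontal {h : ℂ → ℂ} {ε : ℝ → ℝ}
    (hε : Tendsto ε atTop (𝓝 0)) (hab : a ≤ b) {κ : ℝ → ℝ}
    (hh : ∀ᶠ N in atTop, ∀ s : ℂ, a ≤ s.re → s.re ≤ b → s.im = κ N → ‖h s‖ ≤ ε N) :
    Tendsto (fun N : ℝ => ∫ x in a..b, h (x + κ N * I)) atTop (𝓝 0) := by
  refine squeeze_zero_norm' ?_ (by simpa using hε.mul_const |b - a|)
  filter_upwards [hh] with N hN
  refine intervalIntegral.norm_integral_le_of_norm_le_const fun x hx => ?_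
  rw [Set.uIoc_of_le hab] at hx
  exact hN _ (by simpa using hx.1.le) (by simpa using hx.2) (by simp)

/-- Moving a vertical line of integration across a disc that contains all singularities. -/
theorem integral_vertical_sub_eq_circleIntegral (hR : 0 < R)
    (hball : Metric.closedBall z₀ R ⊆ {s : ℂ | a < s.re ∧ s.re < b})
    (hg : ∀ s : ℂ, a ≤ s.re → s.re ≤ b → s ∉ Metric.ball z₀ R → DifferentiableAt ℂ g s)
    (hbd : ∀ s : ℂ, a ≤ s.re → s.re ≤ b → T ≤ |s.im| → ‖g s‖ ≤ C / |s.im| ^ 2) :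
    I * ((∫ t : ℝ, g (b + t * I)) - ∫ t : ℝ, g (a + t * I)) = ∮ z in C(z₀, R), g z := by
  obtain ⟨ha, hb⟩ := re_add_radius_lt_of_closedBall_subset hR hball
  have hab : a ≤ b := by linarith
  have hsph : ContinuousOn g (Metric.sphere z₀ R) := fun z hz => by
    have := hball (Metric.sphere_subset_closedBall hz)
    exact (hg z this.1.le this.2.le fun h => by
      rw [mem_sphere_iff_norm] at hz
      rw [mem_ball_iff_norm] at h
      linarith).continuousAt.continuousWithinAt
  -- Half the gap to the nearer line: the disc of radius `R'` is larger than the given one and still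
  -- lies in the strip.
  set R' := R + min (z₀.re - R - a) (b - (z₀.re + R)) / 2 with hR'
  have hmin : 0 < min (z₀.re - R - a) (b - (z₀.re + R)) := lt_min (by linarith) (by linarith)
  have hRR' : R < R' := by linarith
  have hball' : ∀ s ∈ Metric.closedBall z₀ R', a ≤ s.re ∧ s.re ≤ b := by
    intro s hs
    rw [mem_closedBall_iff_norm] at hs
    have := abs_le.1 ((abs_re_sub_le_norm s z₀).trans hs)
    have h1 := min_le_left (z₀.re - R - a) (b - (z₀.re + R))
    have h2 := min_le_right (z₀.re - R - a) (b - (z₀.re + R))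
    exact ⟨by linarith, by linarith⟩
  obtain ⟨h, hh, hhg⟩ := exists_differentiableAt_ball_eq_sub_cauchyTransform hR hRR'
    (fun s hs hs' => hg s (hball' s hs).1 (hball' s hs).2 hs')
  set G := fun s => (2 * Real.pi * I : ℂ)⁻¹ *
    cauchyTransform angleMeasure (circleDensity g z₀ R) (circleMap z₀ R) s with hG
  classical
  -- `H` is `g` minus its principal part, glued from the inner extension and the outer difference;
  -- it is holomorphic at every point of the closed strip.
  set H : ℂ → ℂ := fun s => if s ∈ Metric.ball z₀ R' then h s else g s - G s with hH
  have hHG : ∀ s, s ∉ Metric.closedBall z₀ R → H s = g s - G s := by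
    intro s hs
    by_cases hs' : s ∈ Metric.ball z₀ R'
    · rw [hH]
      simp only [if_pos hs']
      exact hhg s hs' hs
    · simp only [hH, if_neg hs']
  have hGd : ∀ s, s ∉ Metric.closedBall z₀ R → DifferentiableAt ℂ G s := fun s hs =>
    (differentiableAt_cauchyTransform_circle hR.le hsph hs).const_mul _
  have hHd : ∀ s : ℂ, a ≤ s.re → s.re ≤ b → DifferentiableAt ℂ H s := by
    intro s h1 h2
    by_cases hs : s ∈ Metric.ball z₀ R'
    · refine (hh s hs).congr_of_eventuallyEq ?_
      filter_upwards [Metric.isOpen_ball.mem_nhds hs] with z hz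
      simp only [hH, if_pos hz]
    · have hs' : s ∉ Metric.closedBall z₀ R := fun h =>
        hs (Metric.closedBall_subset_ball hRR' h)
      refine ((hg s h1 h2 fun h => hs' (Metric.ball_subset_closedBall h)).sub
        (hGd s hs')).congr_of_eventuallyEq ?_
      filter_upwards [Metric.isClosed_closedBall.isOpen_compl.mem_nhds hs'] with z hz
      exact hHG z hz
  have hline : ∀ x : ℝ, (x < z₀.re - R ∨ z₀.re + R < x) → ∀ t : ℝ,
      (x + t * I : ℂ) ∉ Metric.closedBall z₀ R := by
    intro x hx t hs
    rw [mem_closedBall_iff_norm] at hs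
    have := abs_le.1 ((abs_re_sub_le_norm _ z₀).trans hs)
    simp at this
    rcases hx with hx | hx <;> linarith
  have hla := hline a (Or.inl ha)
  have hlb := hline b (Or.inr hb)
  have hgint : ∀ x : ℝ, a ≤ x → x ≤ b → (∀ t : ℝ, (x + t * I : ℂ) ∉ Metric.closedBall z₀ R) →
      Integrable fun t : ℝ => g (x + t * I) := by
    intro x h1 h2 h3
    refine integrable_of_norm_le_div_sq (T := T) (C := C) ?_ fun t ht => ?_
    · refine continuous_iff_continuousAt.2 fun t => ?_
      exact ContinuousAt.comp (f := fun t : ℝ => (x + t * I : ℂ)) (hg _ (by simpa) (by simpa)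
        fun h => h3 t (Metric.ball_subset_closedBall h)).continuousAt (by fun_prop)
    · simpa using hbd (x + t * I) (by simpa) (by simpa) (by simpa)
  have hga := hgint a le_rfl hab hla
  have hgb := hgint b hab le_rfl hlb
  obtain ⟨hGint, hGval⟩ := integral_cauchyTransform_vertical_sub hR ha hb hsph
  have hHline : ∀ t : ℝ, H (b + t * I) - H (a + t * I) =
      (g (b + t * I) - g (a + t * I)) - (2 * Real.pi * I : ℂ)⁻¹ *
      (cauchyTransform angleMeasure (circleDensity g z₀ R) (circleMap z₀ R) (b + t * I) -
        cauchyTransform angleMeasure (circleDensity g z₀ R) (circleMap z₀ R) (a + t * I)) := by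
    intro t
    rw [hHG _ (hla t), hHG _ (hlb t)]
    simp only [hG]
    ring
  -- The Cauchy transform is controlled only to order 1/|s| on one line, so the argument works with
  -- the difference of the two lines.
  have hHint : Integrable fun t : ℝ => H (b + t * I) - H (a + t * I) := by
    simp only [hHline]
    exact (hgb.sub hga).sub (hGint.const_mul _)
  have hlim1 : Tendsto (fun N : ℝ => ∫ t in (-N)..N, (H (b + t * I) - H (a + t * I))) atTop
      (𝓝 (∫ t : ℝ, (H (b + t * I) - H (a + t * I)))) :=
    intervalIntegral_tendsto_integral hHint tendsto_neg_atTop_atBot tendsto_id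
  set D := ∫ θ, ‖circleDensity g z₀ R θ‖ ∂angleMeasure
  have hHbd : ∀ s : ℂ, a ≤ s.re → s.re ≤ b → T ≤ |s.im| → R + |z₀.im| < |s.im| →
      ‖H s‖ ≤ C / |s.im| ^ 2 + ‖(2 * Real.pi * I : ℂ)⁻¹‖ * (D / (|s.im| - (R + |z₀.im|))) := by
    intro s h1 h2 h3 h4
    have h5 : |s.im| - |z₀.im| ≤ ‖s - z₀‖ :=
      (abs_sub_abs_le_abs_sub _ _).trans (abs_im_sub_le_norm s z₀)
    have hs : s ∉ Metric.closedBall z₀ R := by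
      rw [mem_closedBall_iff_norm]
      linarith
    rw [hHG s hs]
    refine (norm_sub_le _ _).trans (add_le_add (hbd s h1 h2 h3) ?_)
    rw [hG, norm_mul]
    refine mul_le_mul_of_nonneg_left ?_ (norm_nonneg _)
    exact norm_cauchyTransform_le (integrable_circleDensity hR.le hsph) (by linarith)
      fun θ => le_trans (by linarith) (sub_le_norm_sub_circleMap hR.le s θ)
  have hε : Tendsto (fun N : ℝ => C / N ^ 2 +
      ‖(2 * Real.pi * I : ℂ)⁻¹‖ * (D / (N - (R + |z₀.im|)))) atTop (𝓝 0) := by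
    have h1 : Tendsto (fun N : ℝ => C / N ^ 2) atTop (𝓝 0) :=
      tendsto_const_nhds.div_atTop (tendsto_pow_atTop two_ne_zero)
    have h2 : Tendsto (fun N : ℝ => D / (N - (R + |z₀.im|))) atTop (𝓝 0) :=
      tendsto_const_nhds.div_atTop (tendsto_atTop_add_const_right _ _ tendsto_id)
    simpa using h1.add (h2.const_mul ‖(2 * Real.pi * I : ℂ)⁻¹‖)
  have hev : ∀ κ : ℝ → ℝ, (∀ N, 0 ≤ N → |κ N| = N) → ∀ᶠ N in atTop, ∀ s : ℂ, a ≤ s.re →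
      s.re ≤ b → s.im = κ N → ‖H s‖ ≤ C / N ^ 2 +
        ‖(2 * Real.pi * I : ℂ)⁻¹‖ * (D / (N - (R + |z₀.im|))) := by
    intro κ hκ
    filter_upwards [eventually_ge_atTop 0, eventually_ge_atTop T,
      eventually_gt_atTop (R + |z₀.im|)] with N h0 hT hN s h1 h2 h3
    have := hHbd s h1 h2
    rw [h3, hκ N h0] at this
    exact this hT hN
  have htop := tendsto_intervalIntegral_horizontal hε hab
    (hev (fun N => N) fun N hN => abs_of_nonneg hN)
  have hbot := tendsto_intervalIntegral_horizontal hε hab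
    (hev (fun N => -N) fun N hN => by rw [abs_neg, abs_of_nonneg hN])
  -- Cauchy's theorem for `H` on the rectangle of height 2N. The horizontal sides have fixed length,
  -- so any bound on `H` tending to 0 makes them vanish in the limit.
  have hrect : ∀ N : ℝ, ∫ t in (-N)..N, (H (b + t * I) - H (a + t * I)) =
      I * ((∫ x in a..b, H (x + ((-N : ℝ) : ℂ) * I)) - ∫ x in a..b, H (x + N * I)) := by
    intro N
    have hcont : ∀ x : ℝ, a ≤ x → x ≤ b → Continuous fun t : ℝ => H (x + t * I) :=
      fun x h1 h2 => continuous_iff_continuousAt.2 fun t =>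
        ContinuousAt.comp (f := fun t : ℝ => (x + t * I : ℂ))
          (hHd _ (by simpa) (by simpa)).continuousAt (by fun_prop)
    rw [intervalIntegral.integral_sub ((hcont b hab le_rfl).intervalIntegrable _ _)
      ((hcont a le_rfl hab).intervalIntegrable _ _)]
    have hre : ∀ x y : ℝ, ((x : ℂ) + y * I).re = x := by simp
    have him : ∀ x y : ℝ, ((x : ℂ) + y * I).im = y := by simp
    have := integral_boundary_rect_eq_zero_of_differentiableOn H (a + (-N : ℝ) * I)
      (b + N * I) (fun s hs => by
        rw [mem_reProdIm, hre, hre, Set.uIcc_of_le hab] at hs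
        exact (hHd s hs.1.1 hs.1.2).differentiableWithinAt)
    rw [hre, hre, him, him, smul_eq_mul, smul_eq_mul] at this
    linear_combination (-I) * this +
      ((∫ t in (-N)..N, H (b + t * I)) - ∫ t in (-N)..N, H (a + t * I)) * I_mul_I
  have hlim2 := (hbot.sub htop).const_mul I
  rw [sub_zero, mul_zero] at hlim2
  have hzero := tendsto_nhds_unique (hlim1.congr hrect) hlim2
  have hgba : Integrable fun t : ℝ => g (b + t * I) - g (a + t * I) := hgb.sub hga
  simp only [hHline] at hzero
  rw [integral_sub hgba (hGint.const_mul _), integral_sub hgb hga, integral_const_mul,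
    hGval] at hzero
  have hpi : (Real.pi : ℂ) ≠ 0 := by exact_mod_cast Real.pi_ne_zero
  have hI := I_ne_zero
  generalize (∫ t : ℝ, g (b + t * I)) - ∫ t : ℝ, g (a + t * I) = X at hzero ⊢
  field_simp at hzero
  linear_combination hzero

end ContourShift

/-! ### Mellin transforms of superpositions of powers. -/

section MellinFubini

variable {Ω : Type*} [MeasurableSpace Ω] {μ : Measure Ω} {f w : Ω → ℂ}

theorem norm_ofReal_cpow_of_pos {v : ℝ} (hv : 0 < v) (z : ℂ) : ‖(v : ℂ) ^ z‖ = v ^ z.re :=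
  norm_cpow_eq_rpow_re_of_pos hv z

theorem aestronglyMeasurable_mul_cpow (hf : Integrable f μ) (hw : Measurable w) (s : ℂ)
    (S : Set ℝ) :
    AEStronglyMeasurable (Function.uncurry fun (v : ℝ) θ => f θ * (v : ℂ) ^ (s - 1 - w θ))
      ((volume.restrict S).prod μ) := by
  refine (hf.aestronglyMeasurable.comp_snd).mul (Measurable.aestronglyMeasurable ?_)
  exact (measurable_ofReal.comp measurable_fst).pow
    (measurable_const.sub (hw.comp measurable_snd))

/-- Mellin transform over `(0, 1]` of a superposition of powers `v ^ (-w)`. -/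
theorem mellin_Ioc_superposition [SFinite μ] (hf : Integrable f μ) (hw : Measurable w) {A : ℝ} {s : ℂ}
    (hA : ∀ θ, (w θ).re ≤ A) (hs : A < s.re) :
    Integrable (fun v : ℝ => ∫ θ, f θ * (v : ℂ) ^ (s - 1 - w θ) ∂μ)
      (volume.restrict (Set.Ioc 0 1)) ∧
    ∫ v in Set.Ioc (0 : ℝ) 1, ∫ θ, f θ * (v : ℂ) ^ (s - 1 - w θ) ∂μ =
      cauchyTransform μ f w s := by
  have hdom : IntegrableOn (fun v : ℝ => v ^ (s.re - 1 - A)) (Set.Ioc 0 1) := by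
    rw [← intervalIntegrable_iff_integrableOn_Ioc_of_le zero_le_one]
    exact intervalIntegral.intervalIntegrable_rpow' (by linarith)
  have hprod : Integrable (Function.uncurry fun (v : ℝ) θ => f θ * (v : ℂ) ^ (s - 1 - w θ))
      ((volume.restrict (Set.Ioc 0 1)).prod μ) := by
    refine Integrable.mono' (Integrable.mul_prod hdom hf.norm)
      (aestronglyMeasurable_mul_cpow hf hw s _) ?_
    have h1 : ∀ᵐ p : ℝ × Ω ∂((volume.restrict (Set.Ioc 0 1)).prod μ), p.1 ∈ Set.Ioc (0 : ℝ) 1 :=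
      Measure.quasiMeasurePreserving_fst.ae (ae_restrict_mem measurableSet_Ioc)
    filter_upwards [h1] with p hp
    rw [Function.uncurry, norm_mul, norm_ofReal_cpow_of_pos hp.1, mul_comm]
    refine mul_le_mul_of_nonneg_right ?_ (norm_nonneg _)
    exact Real.rpow_le_rpow_of_exponent_ge hp.1 hp.2 (by simp; linarith [hA p.2])
  refine ⟨hprod.integral_prod_left, ?_⟩
  rw [integral_integral_swap hprod, cauchyTransform]
  congr 1
  funext θ
  have hre : 0 < (s - w θ).re := by simp; linarith [hA θ]
  have hne : s - w θ ≠ 0 := fun h => by simp [h] at hre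
  rw [integral_const_mul, ← intervalIntegral.integral_of_le zero_le_one,
    integral_cpow (Or.inl (by simp at hre ⊢; linarith)), show s - 1 - w θ + 1 = s - w θ by ring]
  simp [zero_cpow hne, div_eq_mul_inv]

/-- Mellin transform over `(1, ∞)` of a superposition of powers `v ^ (-w)`. -/
theorem mellin_Ioi_superposition [SFinite μ] (hf : Integrable f μ) (hw : Measurable w) {A : ℝ} {s : ℂ}
    (hA : ∀ θ, A ≤ (w θ).re) (hs : s.re < A) :
    Integrable (fun v : ℝ => ∫ θ, f θ * (v : ℂ) ^ (s - 1 - w θ) ∂μ)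
      (volume.restrict (Set.Ioi 1)) ∧
    ∫ v in Set.Ioi (1 : ℝ), ∫ θ, f θ * (v : ℂ) ^ (s - 1 - w θ) ∂μ =
      -cauchyTransform μ f w s := by
  have hdom : IntegrableOn (fun v : ℝ => v ^ (s.re - 1 - A)) (Set.Ioi 1) :=
    integrableOn_Ioi_rpow_of_lt (by linarith) one_pos
  have hprod : Integrable (Function.uncurry fun (v : ℝ) θ => f θ * (v : ℂ) ^ (s - 1 - w θ))
      ((volume.restrict (Set.Ioi 1)).prod μ) := by
    refine Integrable.mono' (Integrable.mul_prod hdom hf.norm)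
      (aestronglyMeasurable_mul_cpow hf hw s _) ?_
    have h1 : ∀ᵐ p : ℝ × Ω ∂((volume.restrict (Set.Ioi 1)).prod μ), p.1 ∈ Set.Ioi (1 : ℝ) :=
      Measure.quasiMeasurePreserving_fst.ae (ae_restrict_mem measurableSet_Ioi)
    filter_upwards [h1] with p hp
    rw [Function.uncurry, norm_mul, norm_ofReal_cpow_of_pos (one_pos.trans hp), mul_comm]
    refine mul_le_mul_of_nonneg_right ?_ (norm_nonneg _)
    exact Real.rpow_le_rpow_of_exponent_le (le_of_lt hp) (by simp; linarith [hA p.2])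
  refine ⟨hprod.integral_prod_left, ?_⟩
  rw [integral_integral_swap hprod, cauchyTransform, ← integral_neg]
  congr 1
  funext θ
  have hre : (s - w θ).re < 0 := by simp; linarith [hA θ]
  rw [integral_const_mul, integral_Ioi_cpow_of_lt (by simp at hre ⊢; linarith) one_pos,
    show s - 1 - w θ + 1 = s - w θ by ring]
  simp [div_eq_mul_inv]

end MellinFubini

/-! ### The Mellin transform of the Riesz mean. -/

section RieszMean

/-- The kernel `(1 - v)^ρ` on `v < 1`, extended by zero. -/
noncomputable def rieszCutoff (ρ v : ℝ) : ℂ := if v < 1 then (((1 - v) ^ ρ : ℝ) : ℂ) else 0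

theorem rieszCutoff_mellin {ρ : ℝ} (hρ : 0 ≤ ρ) {s : ℂ} (hs : 0 < s.re) :
    MellinConvergent (rieszCutoff ρ) s ∧ mellin (rieszCutoff ρ) s = s.betaIntegral (ρ + 1) := by
  have hconv := betaIntegral_convergent (u := s) (v := ρ + 1) hs (by simp; linarith)
  rw [intervalIntegrable_iff_integrableOn_Ioo_of_le zero_le_one] at hconv
  have heq : Set.EqOn (fun v : ℝ => (v : ℂ) ^ (s - 1) * (1 - (v : ℂ)) ^ ((ρ : ℂ) + 1 - 1))
      (fun v : ℝ => (v : ℂ) ^ (s - 1) • rieszCutoff ρ v) (Set.Ioo 0 1) := by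
    intro v hv
    simp only [rieszCutoff, if_pos hv.2, smul_eq_mul]
    rw [ofReal_cpow (by linarith [hv.2])]
    simp
  have hzero : ∀ v ∈ Set.Ioi (0 : ℝ) \ Set.Ioo 0 1, (v : ℂ) ^ (s - 1) • rieszCutoff ρ v = 0 := by
    rintro v ⟨h1, h2⟩
    have h3 : ¬ v < 1 := fun h => h2 ⟨h1, h⟩
    simp [rieszCutoff, h3]
  refine ⟨?_, ?_⟩
  · rw [MellinConvergent]
    exact (hconv.congr_fun heq measurableSet_Ioo).of_forall_sdiff_eq_zero measurableSet_Ioi hzero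
  · rw [mellin, betaIntegral, intervalIntegral.integral_of_le zero_le_one,
      integral_Ioc_eq_integral_Ioo, setIntegral_congr_fun measurableSet_Ioo heq,
      setIntegral_eq_of_subset_of_forall_sdiff_eq_zero measurableSet_Ioi
        (fun v hv => hv.1) hzero]

/-- Since κ ≥ 1, the dilated cutoff vanishes beyond v = 1, so (0,1] carries the full Mellin
transform and scaling produces κ^(-s). The norm estimate provides summability over n. -/
theorem rieszCutoff_mellin_comp_mul {ρ : ℝ} (hρ : 0 ≤ ρ) {κ : ℝ} (hκ : 1 ≤ κ) {s : ℂ}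
    (hs : 0 < s.re) :
    IntegrableOn (fun v : ℝ => (v : ℂ) ^ (s - 1) * rieszCutoff ρ (κ * v)) (Set.Ioc 0 1) ∧
    ∫ v in Set.Ioc (0 : ℝ) 1, (v : ℂ) ^ (s - 1) * rieszCutoff ρ (κ * v) =
      (κ : ℂ) ^ (-s) * s.betaIntegral (ρ + 1) ∧
    ∫ v in Set.Ioc (0 : ℝ) 1, ‖(v : ℂ) ^ (s - 1) * rieszCutoff ρ (κ * v)‖ ≤
      κ ^ (-s.re) * ∫ v in Set.Ioi (0 : ℝ), ‖(v : ℂ) ^ (s - 1) * rieszCutoff ρ v‖ := by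
  have hκ0 : 0 < κ := one_pos.trans_le hκ
  obtain ⟨h1, h2⟩ := rieszCutoff_mellin hρ hs
  have h3 : IntegrableOn (fun v : ℝ => (v : ℂ) ^ (s - 1) * rieszCutoff ρ (κ * v)) (Set.Ioi 0) := by
    simpa [MellinConvergent] using (MellinConvergent.comp_mul_left hκ0).2 h1
  have hsub : Set.Ioc (0 : ℝ) 1 ⊆ Set.Ioi 0 := fun v hv => hv.1
  refine ⟨h3.mono_set hsub, ?_, ?_⟩
  · have h4 := mellin_comp_mul_left (rieszCutoff ρ) s hκ0
    rw [h2, smul_eq_mul] at h4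
    rw [← h4, mellin]
    refine (setIntegral_eq_of_subset_of_forall_sdiff_eq_zero measurableSet_Ioi hsub ?_).symm
    rintro v ⟨hv1, hv2⟩
    have hv3 : 1 < v := not_le.1 fun h => hv2 ⟨hv1, h⟩
    have hv4 : ¬ κ * v < 1 := by nlinarith
    simp [rieszCutoff, hv4]
  · refine (setIntegral_mono_set h3.norm (Eventually.of_forall fun v => norm_nonneg _)
      hsub.eventuallyLE).trans (le_of_eq ?_)
    have h5 := integral_comp_mul_left_Ioi
      (fun v : ℝ => ‖(v : ℂ) ^ (s - 1) * rieszCutoff ρ v‖) 0 hκ0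
    rw [mul_zero, smul_eq_mul] at h5
    have h6 : Set.EqOn (fun v : ℝ => ‖((κ * v : ℝ) : ℂ) ^ (s - 1) * rieszCutoff ρ (κ * v)‖)
        (fun v : ℝ => κ ^ (s.re - 1) * ‖(v : ℂ) ^ (s - 1) * rieszCutoff ρ (κ * v)‖)
        (Set.Ioi 0) := by
      intro v hv
      have hv0 : 0 < v := hv
      simp only [norm_mul, norm_ofReal_cpow_of_pos (mul_pos hκ0 hv0), norm_ofReal_cpow_of_pos hv0,
        Real.mul_rpow hκ0.le hv0.le]
      simp
      ring
    rw [setIntegral_congr_fun measurableSet_Ioi h6, integral_const_mul] at h5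
    have h7 : κ ^ (-s.re) * (κ * κ ^ (s.re - 1)) = 1 := by
      rw [mul_comm κ, ← Real.rpow_add_one hκ0.ne', ← Real.rpow_add hκ0]
      simp
    have h8 : κ * κ⁻¹ = 1 := mul_inv_cancel₀ hκ0.ne'
    calc _ = κ ^ (-s.re) * (κ * κ ^ (s.re - 1)) *
          ∫ v in Set.Ioi (0 : ℝ), ‖(v : ℂ) ^ (s - 1) * rieszCutoff ρ (κ * v)‖ := by
            rw [h7, one_mul]
      _ = κ ^ (-s.re) * κ * (κ ^ (s.re - 1) *
          ∫ v in Set.Ioi (0 : ℝ), ‖(v : ℂ) ^ (s - 1) * rieszCutoff ρ (κ * v)‖) := by ring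
      _ = _ := by rw [h5, ← mul_assoc, mul_assoc (κ ^ (-s.re)), h8, mul_one]

namespace RieszModular

variable {a : ℕ → ℂ} {lam : ℕ → ℝ} {σa ρ : ℝ}

/-- `x ^ (-ρ)` times the Riesz mean at `x = lam 0 / v`. -/
noncomputable def scaledRiesz (a : ℕ → ℂ) (lam : ℕ → ℝ) (ρ v : ℝ) : ℂ :=
  (((lam 0 / v) ^ (-ρ) : ℝ) : ℂ) * rieszMean a lam ρ (lam 0 / v)

/-- Here x = `lam 0 / v` lies below the first frequency, so the sum is empty. Normalising by `lam 0`
places this threshold at v = 1. -/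
theorem IsFrequency.scaledRiesz_eq_zero (hlam : IsFrequency lam) {v : ℝ} (hv : 1 < v) :
    scaledRiesz a lam ρ v = 0 := by
  have h : ∀ n, ¬ lam n ≤ lam 0 / v := fun n hn => by
    rw [le_div_iff₀ (by linarith)] at hn
    have h1 := hlam.strictMono.monotone (Nat.zero_le n)
    have h2 := hlam.pos n
    nlinarith
  simp [scaledRiesz, rieszMean, h]

/-- The exceptional points v = λ/λ_n, with λ = `lam 0`, are countable. There the halved last term
and the strict inequality in the cutoff would matter; elsewhere the two expressions agree term by
term. -/
theorem IsFrequency.scaledRiesz_ae (hlam : IsFrequency lam) :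
    ∀ᵐ v : ℝ ∂(volume.restrict (Set.Ioc 0 1)), scaledRiesz a lam ρ v =
      1 / Gamma ((ρ : ℂ) + 1) * ∑' n, a n * rieszCutoff ρ (lam n / lam 0 * v) := by
  have hL := hlam.pos 0
  have hcount : (Set.range fun n => lam 0 / lam n).Countable := Set.countable_range _
  filter_upwards [ae_restrict_mem measurableSet_Ioc,
    ae_restrict_of_ae (hcount.ae_notMem volume)] with v hv hv'
  have hv0 : 0 < v := hv.1
  have hx : 0 < lam 0 / v := div_pos hL hv0
  rw [scaledRiesz, rieszMean, mul_left_comm, ← tsum_mul_left]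
  congr 2
  funext n
  have hne : lam n ≠ lam 0 / v := fun h => hv' ⟨n, by
    have := hlam.pos n
    rw [eq_div_iff hv0.ne'] at h
    simp only
    rw [div_eq_iff this.ne']
    linarith⟩
  have hiff : lam n / lam 0 * v < 1 ↔ lam n ≤ lam 0 / v := by
    rw [div_mul_eq_mul_div, div_lt_one hL, ← lt_div_iff₀ hv0]
    exact ⟨le_of_lt, fun h => lt_of_le_of_ne h hne⟩
  by_cases h : lam n ≤ lam 0 / v
  · simp only [rieszCutoff, if_pos h, if_pos (hiff.2 h), if_neg (fun h' => hne h'.2 :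
      ¬ (ρ = 0 ∧ lam n = lam 0 / v)), one_mul]
    rw [mul_left_comm, ← ofReal_mul]
    congr 2
    have h1 : 1 - lam n / lam 0 * v = (lam 0 / v - lam n) / (lam 0 / v) := by
      field_simp
    rw [h1, Real.div_rpow (sub_nonneg.2 h) hx.le, Real.rpow_neg hx.le]
    exact inv_mul_eq_div _ _
  · simp [rieszCutoff, h, hiff]

/-- The Mellin transform of the Riesz mean. -/
theorem IsFrequency.integral_scaledRiesz (hlam : IsFrequency lam) (hσa : IsAbscissa a lam σa)
    (hρ : 0 ≤ ρ) {s : ℂ} (hs : 0 < s.re) (hsa : σa < s.re) :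
    ∫ v in Set.Ioc (0 : ℝ) 1, (v : ℂ) ^ (s - 1) * scaledRiesz a lam ρ v =
      (lam 0 : ℂ) ^ s * dirichletSeries a lam s * Gamma s / Gamma (s + ρ + 1) := by
  have hL := hlam.pos 0
  have hκ : ∀ n, 1 ≤ lam n / lam 0 := fun n =>
    (one_le_div hL).2 (hlam.strictMono.monotone (Nat.zero_le n))
  set M := ∫ v in Set.Ioi (0 : ℝ), ‖(v : ℂ) ^ (s - 1) * rieszCutoff ρ v‖
  -- The L¹ norm of the n-th term is at most a constant times |a_n| λ_n^(-Re s), which is summable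
  -- to the right of the abscissa.
  have hsum : Summable fun n => ∫ v in Set.Ioc (0 : ℝ) 1,
      ‖a n * ((v : ℂ) ^ (s - 1) * rieszCutoff ρ (lam n / lam 0 * v))‖ := by
    refine Summable.of_nonneg_of_le (fun n => integral_nonneg fun v => norm_nonneg _) (fun n => ?_)
      (((hlam.summable_of_abscissa_lt hσa hsa).mul_right (lam 0 ^ s.re * M)))
    simp only [norm_mul (a n), integral_const_mul]
    refine (mul_le_mul_of_nonneg_left (rieszCutoff_mellin_comp_mul hρ (hκ n) hs).2.2
      (norm_nonneg _)).trans (le_of_eq ?_)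
    rw [Real.div_rpow (hlam.pos n).le hL.le, Real.rpow_neg hL.le, div_inv_eq_mul]
    ring
  have key := hasSum_integral_of_summable_integral_norm
    (fun n => ((rieszCutoff_mellin_comp_mul hρ (hκ n) hs).1.const_mul (a n))) hsum
  have hterm : ∀ n, ∫ v in Set.Ioc (0 : ℝ) 1,
      a n * ((v : ℂ) ^ (s - 1) * rieszCutoff ρ (lam n / lam 0 * v)) =
      (lam 0 : ℂ) ^ s * s.betaIntegral (ρ + 1) * (a n * (lam n : ℂ) ^ (-s)) := by
    intro n
    have hL0 : (lam 0 : ℂ) ≠ 0 := by exact_mod_cast hL.ne'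
    rw [integral_const_mul, (rieszCutoff_mellin_comp_mul hρ (hκ n) hs).2.1, ofReal_div,
      div_cpow_ofReal_nonneg (hlam.pos n).le hL.le, cpow_neg (lam 0 : ℂ), div_inv_eq_mul]
    ring
  have hG : Gamma ((ρ : ℂ) + 1) ≠ 0 := Gamma_ne_zero_of_re_pos (by simp; linarith)
  have hG' : Gamma (s + ρ + 1) ≠ 0 := Gamma_ne_zero_of_re_pos (by simp; linarith)
  have hbeta := Gamma_mul_Gamma_eq_betaIntegral (s := s) (t := ρ + 1) hs (by simp; linarith)
  rw [← add_assoc] at hbeta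
  have hint : ∫ v in Set.Ioc (0 : ℝ) 1, (v : ℂ) ^ (s - 1) * scaledRiesz a lam ρ v =
      1 / Gamma ((ρ : ℂ) + 1) * ∫ v in Set.Ioc (0 : ℝ) 1,
        ∑' n, a n * ((v : ℂ) ^ (s - 1) * rieszCutoff ρ (lam n / lam 0 * v)) := by
    rw [← integral_const_mul]
    refine integral_congr_ae ?_
    filter_upwards [hlam.scaledRiesz_ae (a := a) (ρ := ρ)] with v hv
    rw [hv, mul_left_comm, ← tsum_mul_left]
    congr 2
    funext n
    ring
  simp only [hterm] at key
  rw [hint, ← key.tsum_eq, tsum_mul_left, dirichletSeries]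
  field_simp
  linear_combination -hbeta * (lam 0 : ℂ) ^ s * ∑' n, a n * (lam n : ℂ) ^ (-s)

end RieszModular

end RieszMean

/-! ### The product Γ F with removable singularities filled in. -/

section RegularizedGamma

open Topology

/-- The zeros of 1/Γ are simple: 1/Γ(z) = z/Γ(z+1) gives derivative 1/Γ(1) = 1 at 0, and carries a
nonzero derivative from -k to -(k+1). -/
theorem deriv_one_div_Gamma_ne_zero {s : ℂ} (hs : Gamma s = 0) :
    deriv (fun z => (Gamma z)⁻¹) s ≠ 0 := by
  obtain ⟨k, rfl⟩ := Gamma_eq_zero_iff s |>.1 hs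
  clear hs
  induction k with
  | zero =>
    have h : (fun z => (Gamma z)⁻¹) = fun z => z * (Gamma (z + 1))⁻¹ :=
      funext fun z => one_div_Gamma_eq_self_mul_one_div_Gamma_add_one z
    have hd := (hasDerivAt_id' (-((0 : ℕ) : ℂ))).fun_mul
      ((differentiable_one_div_Gamma (-((0 : ℕ) : ℂ) + 1)).hasDerivAt.comp_add_const _ 1)
    rw [h, hd.deriv]
    simp
  | succ k ih =>
    have h : (fun z => (Gamma z)⁻¹) = fun z => z * (Gamma (z + 1))⁻¹ :=
      funext fun z => one_div_Gamma_eq_self_mul_one_div_Gamma_add_one z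
    have hz : -((k + 1 : ℕ) : ℂ) + 1 = -(k : ℂ) := by push_cast; ring
    have h1 : HasDerivAt (fun z => (Gamma (z + 1))⁻¹)
        (deriv (fun z => (Gamma z)⁻¹) (-(k : ℂ))) (-((k + 1 : ℕ) : ℂ)) := by
      have := (differentiable_one_div_Gamma (-((k + 1 : ℕ) : ℂ) + 1)).hasDerivAt.comp_add_const
        (-((k + 1 : ℕ) : ℂ)) 1
      rwa [hz] at this
    rw [h, ((hasDerivAt_id' (-((k + 1 : ℕ) : ℂ))).fun_mul h1).deriv]
    have h2 : ((k : ℂ) + 1) ≠ 0 := by exact_mod_cast Nat.succ_ne_zero k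
    have h3 : -1 + -(k : ℂ) ≠ 0 := fun h => h2 (by linear_combination -h)
    simpa [hz, Gamma_neg_nat_eq_zero, h3] using ih

/-- The product `Γ F`, with the removable singularities at the zeros of `F` among the poles of
`Γ` filled in. -/
noncomputable def regGammaMul (F : ℂ → ℂ) (s : ℂ) : ℂ :=
  if Gamma s = 0 then deriv F s / deriv (fun z => (Gamma z)⁻¹) s else Gamma s * F s

theorem regGammaMul_of_ne_zero {F : ℂ → ℂ} {s : ℂ} (hs : Gamma s ≠ 0) :
    regGammaMul F s = Gamma s * F s :=
  if_neg hs

/-- At a pole of Γ where F vanishes, Γ F = F/(1/Γ) is a quotient of two difference quotients based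
at `s`. The lower one is nonzero at `s` because the zero of 1/Γ is simple. -/
theorem differentiableAt_regGammaMul {F : ℂ → ℂ} {s : ℂ} {U : Set ℂ} (hU : U ∈ 𝓝 s)
    (hF : DifferentiableOn ℂ F U) (h : Gamma s = 0 → F s = 0) :
    DifferentiableAt ℂ (regGammaMul F) s := by
  by_cases hs : Gamma s = 0
  · have hE : DifferentiableOn ℂ (fun z => (Gamma z)⁻¹) U :=
      differentiable_one_div_Gamma.differentiableOn
    have h1 := ((differentiableOn_dslope hU).2 hF).differentiableAt hU
    have h2 := ((differentiableOn_dslope hU).2 hE).differentiableAt hU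
    have h3 : dslope (fun z => (Gamma z)⁻¹) s s ≠ 0 := by
      rw [dslope_same]
      exact deriv_one_div_Gamma_ne_zero hs
    refine (h1.div h2 h3).congr_of_eventuallyEq ?_
    filter_upwards [h2.continuousAt.eventually_ne h3] with z hz
    rcases eq_or_ne z s with rfl | hzs
    · simp [regGammaMul, hs]
    · have hzs' := sub_ne_zero.2 hzs
      rw [dslope_of_ne _ hzs, slope_def_field, hs, inv_zero, sub_zero] at hz
      have hGz : Gamma z ≠ 0 := fun h0 => hz (by simp [h0])
      rw [regGammaMul_of_ne_zero hGz, Pi.div_apply, dslope_of_ne _ hzs, dslope_of_ne _ hzs,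
        slope_def_field, slope_def_field, hs, h hs, inv_zero, sub_zero, sub_zero]
      field_simp
  · have hd : DifferentiableAt ℂ Gamma s :=
      differentiableAt_Gamma s fun m hm => hs (Gamma_eq_zero_iff s |>.2 ⟨m, hm⟩)
    refine (hd.mul (hF.differentiableAt hU)).congr_of_eventuallyEq ?_
    filter_upwards [hd.continuousAt.eventually_ne hs] with z hz
    exact regGammaMul_of_ne_zero hz

/-- Poles of Γ may lie on the circle itself. They occupy countably many angles, so `regGammaMul` may
replace Γ F in circle integrals. -/
theorem ae_Gamma_circleMap_ne_zero (z₀ : ℂ) {R : ℝ} (hR : R ≠ 0) :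
    ∀ᵐ θ ∂angleMeasure, Gamma (circleMap z₀ R θ) ≠ 0 := by
  have hcount : (circleMap z₀ R ⁻¹' {s | Gamma s = 0}).Countable := by
    refine Set.Countable.preimage_circleMap ?_ z₀ hR
    refine (Set.countable_range fun k : ℕ => -(k : ℂ)).mono fun s hs => ?_
    obtain ⟨k, rfl⟩ := (Gamma_eq_zero_iff s).1 hs
    exact ⟨k, rfl⟩
  exact ae_restrict_of_ae (hcount.ae_notMem volume)

end RegularizedGamma

/-! ### The jump of a Cauchy transform across a line. -/

section Jump

open Topology

/-- The jump of a Cauchy transform across a vertical line. -/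
theorem tendsto_cauchyTransform_vertical_jump {f : ℝ → ℂ} (hf : Integrable f) {t₀ : ℝ}
    (hc : ContinuousAt f t₀) (x : ℝ) :
    Tendsto (fun k : ℝ =>
      cauchyTransform volume f (fun t : ℝ => (x + t * I : ℂ)) (x + t₀ * I + (k⁻¹ : ℝ)) -
      cauchyTransform volume f (fun t : ℝ => (x + t * I : ℂ)) (x + t₀ * I - (k⁻¹ : ℝ)))
      atTop (𝓝 (2 * Real.pi * f t₀)) := by
  -- At distance 1/k on either side of the line, the two Cauchy kernels differ by 2k/(1 + k²u²),
  -- which is 2π times the Poisson kernel, an approximate identity.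
  have hker := tendsto_integral_comp_smul_smul_of_integrable (F := ℝ) (μ := volume)
    (φ := fun y => Real.pi⁻¹ * (1 + y ^ 2)⁻¹) (fun y => by have := Real.pi_pos; positivity)
    (by rw [integral_const_mul, integral_univ_inv_one_add_sq, inv_mul_cancel₀ Real.pi_ne_zero])
    (by
      simp only [Module.finrank_self, pow_one]
      have h1 : Tendsto (fun y : ℝ => ‖y‖) (Bornology.cobounded ℝ) atTop :=
        tendsto_norm_cobounded_atTop
      have h2 : Tendsto (fun u : ℝ => u * (Real.pi⁻¹ * (1 + u ^ 2)⁻¹)) atTop (𝓝 0) := by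
        refine squeeze_zero' (g := fun u : ℝ => Real.pi⁻¹ * u⁻¹) ?_ ?_ ?_
        · filter_upwards [eventually_ge_atTop 0] with u hu
          have := Real.pi_pos
          positivity
        · filter_upwards [eventually_gt_atTop 0] with u hu
          rw [mul_left_comm]
          refine mul_le_mul_of_nonneg_left ?_ (inv_nonneg.2 Real.pi_pos.le)
          rw [← div_eq_mul_inv, inv_eq_one_div, div_le_div_iff₀ (by positivity) hu]
          nlinarith
        · simpa using tendsto_inv_atTop_zero.const_mul Real.pi⁻¹
      refine (h2.comp h1).congr fun y => ?_
      simp)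
    (g := fun u => f (t₀ + u)) (hf.comp_add_left t₀)
    (ContinuousAt.comp (f := fun u : ℝ => t₀ + u) (by simpa using hc) (by fun_prop))
  simp only [add_zero] at hker
  have h2 := hker.const_mul (2 * Real.pi : ℂ)
  refine h2.congr' ?_
  filter_upwards [eventually_gt_atTop 0] with k hk
  have hwm : Measurable fun t : ℝ => (x + t * I : ℂ) := by fun_prop
  have hre : ∀ (ε : ℝ) (t : ℝ), |ε| ≤ ‖(x + t₀ * I + ε : ℂ) - (x + t * I)‖ := by
    intro ε t
    simpa using abs_re_le_norm ((x + t₀ * I + ε : ℂ) - (x + t * I))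
  have hk' : (0 : ℝ) < k⁻¹ := inv_pos.2 hk
  have i1 := integrable_div_sub hf hwm hk' (s₀ := x + t₀ * I + (k⁻¹ : ℝ)) fun t => by
    simpa only [abs_of_pos hk'] using hre k⁻¹ t
  have i2 := integrable_div_sub hf hwm hk' (s₀ := x + t₀ * I - (k⁻¹ : ℝ)) fun t => by
    have := hre (-k⁻¹) t
    rwa [abs_neg, abs_of_pos hk', ofReal_neg, ← sub_eq_add_neg] at this
  rw [cauchyTransform, cauchyTransform, ← integral_sub i1 i2,
    ← integral_add_left_eq_self (fun t : ℝ => f t / (x + t₀ * I + (k⁻¹ : ℝ) - (x + t * I)) -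
      f t / (x + t₀ * I - (k⁻¹ : ℝ) - (x + t * I))) t₀, ← integral_const_mul]
  congr 1
  funext u
  have hkc : (k : ℂ) ≠ 0 := by exact_mod_cast hk.ne'
  have hpi : (Real.pi : ℂ) ≠ 0 := by exact_mod_cast Real.pi_ne_zero
  have n1 : (1 - k * u * I : ℂ) ≠ 0 := fun h => by simpa using congrArg re h
  have n2 : (1 + k * u * I : ℂ) ≠ 0 := fun h => by simpa using congrArg re h
  have e1 : (x + t₀ * I + (k⁻¹ : ℝ) : ℂ) - (x + (t₀ + u : ℝ) * I) = k⁻¹ * (1 - k * u * I) := by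
    push_cast
    field_simp
    ring
  have e2 : (x + t₀ * I - (k⁻¹ : ℝ) : ℂ) - (x + (t₀ + u : ℝ) * I) = -(k⁻¹ * (1 + k * u * I)) := by
    push_cast
    field_simp
    ring
  have e3 : (1 + (k * u : ℂ) ^ 2) = (1 - k * u * I) * (1 + k * u * I) := by
    linear_combination (k * u : ℂ) ^ 2 * I_sq
  rw [e1, e2]
  simp only [Module.finrank_self, pow_one, smul_eq_mul, real_smul]
  push_cast
  rw [e3]
  field_simp
  ring

end Jump

/-! ### The two terms of the Riesz identity as superpositions of powers. -/

noncomputable section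

namespace RieszModular

open Topology

/-- The standing hypotheses on the Dirichlet series, the Gamma factors and the contours. -/
structure Setting {r : ℕ} (a b : ℕ → ℂ) (lam mu : ℕ → ℝ) (σa σb : ℝ) (α : Fin r → ℝ)
    (β : Fin r → ℂ) (δ Q : ℝ) (K : Set ℂ) (F : ℂ → ℂ) (c : ℝ) (z₀ : ℂ) (R ρ : ℝ) : Prop where
  lam_freq : IsFrequency lam
  mu_freq : IsFrequency mu
  abscissa_a : IsAbscissa a lam σa
  abscissa_b : IsAbscissa b mu σb
  alpha_pos : ∀ i, 0 < α i
  beta_re : ∀ i, 0 ≤ (β i).re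
  Q_pos : 0 < Q
  continuation : IsCompletedContinuation a lam σa α β K F
  c_pos : 0 < c
  lt_c_a : σa < c
  lt_c_b : σb < c
  c_ne : ∀ k : ℕ, c ≠ δ + k
  circle : IsAdmissibleCircle δ c K F z₀ R
  rho_nonneg : 0 ≤ ρ

/-- The conjugate parameters. -/
abbrev conjParam {r : ℕ} (β : Fin r → ℂ) : Fin r → ℂ := fun i => conj (β i)

/-- The function that the functional equation predicts for the continuation `F`. -/
def dualF {r : ℕ} (b : ℕ → ℂ) (mu : ℕ → ℝ) (α : Fin r → ℝ) (β : Fin r → ℂ) (δ Q : ℝ) (ω : ℂ)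
    (s : ℂ) : ℂ :=
  ω * (Q : ℂ) ^ (δ - 2 * s) *
    (gammaProd α (conjParam β) (δ - s) * dirichletSeries (fun n => conj (b n)) mu (δ - s))

/-- The Mellin transform of the Riesz means, as a function on the domain of `F`. -/
def rieszTransform {r : ℕ} (α : Fin r → ℝ) (β : Fin r → ℂ) (F : ℂ → ℂ) (ρ : ℝ) (s : ℂ) : ℂ :=
  regGammaMul F s * ((gammaProd α β s)⁻¹ * (Gamma (s + ρ + 1))⁻¹)

/-- The function that the functional equation predicts for `rieszTransform`. -/
def dualTransform {r : ℕ} (b : ℕ → ℂ) (mu : ℕ → ℝ) (α : Fin r → ℝ) (β : Fin r → ℂ) (δ Q : ℝ)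
    (ω : ℂ) (ρ : ℝ) (s : ℂ) : ℂ :=
  Gamma s * dualF b mu α β δ Q ω s * ((gammaProd α β s)⁻¹ * (Gamma (s + ρ + 1))⁻¹)

/-- The density on the line `Re s = δ - c` of the integral term of the Riesz sum identity. -/
def lineDensity {r : ℕ} (b : ℕ → ℂ) (lam mu : ℕ → ℝ) (α : Fin r → ℝ) (β : Fin r → ℂ) (δ Q : ℝ)
    (ω : ℂ) (c ρ : ℝ) (t : ℝ) : ℂ :=
  (2 * Real.pi : ℂ)⁻¹ * (dualTransform b mu α β δ Q ω ρ ((δ - c : ℝ) + t * I) *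
    (lam 0 : ℂ) ^ (((δ - c : ℝ) : ℂ) + t * I))

/-- The density on the circle of the residual term of the Riesz sum identity. -/
def circlePart {r : ℕ} (lam : ℕ → ℝ) (α : Fin r → ℝ) (β : Fin r → ℂ) (F : ℂ → ℂ) (ρ : ℝ)
    (s : ℂ) : ℂ :=
  (2 * Real.pi * I : ℂ)⁻¹ * (rieszTransform α β F ρ s * (lam 0 : ℂ) ^ s)

theorem differentiable_inv_Gamma_add (ρ : ℝ) : Differentiable ℂ fun s => (Gamma (s + ρ + 1))⁻¹ :=
  differentiable_one_div_Gamma.comp (by fun_prop : Differentiable ℂ fun s : ℂ => s + ρ + 1)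

theorem dualTransform_eq_rieszKernel {r : ℕ} (b : ℕ → ℂ) (mu : ℕ → ℝ) (α : Fin r → ℝ)
    (β : Fin r → ℂ) (δ Q : ℝ) (ω : ℂ) (ρ : ℝ) (s : ℂ) :
    dualTransform b mu α β δ Q ω ρ s = ω * (Q : ℂ) ^ (δ - 2 * s) *
      (rieszKernel α β δ ρ (δ - s) * dirichletSeries (fun n => conj (b n)) mu (δ - s)) := by
  rw [dualTransform, dualF, rieszKernel, sub_sub_cancel, div_eq_mul_inv, mul_inv_rev,
    show (1 + δ - (δ - s) + ρ : ℂ) = s + ρ + 1 by ring]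
  ring

theorem notMem_closedBall_of_re {z₀ : ℂ} {R : ℝ} {s : ℂ}
    (hs : s.re < z₀.re - R ∨ z₀.re + R < s.re) : s ∉ Metric.closedBall z₀ R := by
  intro h1
  rw [mem_closedBall_iff_norm] at h1
  have := abs_le.1 ((abs_re_sub_le_norm s z₀).trans h1)
  rcases hs with hs | hs <;> linarith

namespace Setting

variable {r : ℕ} {a b : ℕ → ℂ} {lam mu : ℕ → ℝ} {σa σb : ℝ} {α : Fin r → ℝ} {β : Fin r → ℂ}
  {δ Q : ℝ} {ω : ℂ} {K : Set ℂ} {F : ℂ → ℂ} {c : ℝ} {z₀ : ℂ} {R ρ : ℝ}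

theorem re_bounds (h : Setting a b lam mu σa σb α β δ Q K F c z₀ R ρ) :
    δ - c < z₀.re - R ∧ z₀.re + R < c :=
  re_add_radius_lt_of_closedBall_subset h.circle.radius_pos h.circle.subset_strip

theorem conj_beta_re (h : Setting a b lam mu σa σb α β δ Q K F c z₀ R ρ) (i : Fin r) :
    0 ≤ (conjParam β i).re := by
  simpa using h.beta_re i

theorem lam_ne_zero (h : Setting a b lam mu σa σb α β δ Q K F c z₀ R ρ) :
    (lam 0 : ℂ) ≠ 0 := by
  exact_mod_cast (h.lam_freq.pos 0).ne'

theorem Q_ne_zero (h : Setting a b lam mu σa σb α β δ Q K F c z₀ R ρ) : (Q : ℂ) ≠ 0 := by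
  exact_mod_cast h.Q_pos.ne'

theorem compl_mem_nhds (h : Setting a b lam mu σa σb α β δ Q K F c z₀ R ρ) {s : ℂ}
    (hs : s ∉ Metric.ball z₀ R) : Kᶜ ∈ 𝓝 s :=
  h.continuation.isCompact.isClosed.isOpen_compl.mem_nhds fun hK =>
    hs (h.circle.singularities_inside hK)

theorem differentiableAt_reg (h : Setting a b lam mu σa σb α β δ Q K F c z₀ R ρ) {s : ℂ}
    (hs : δ - c ≤ s.re) (hs' : s ∉ Metric.ball z₀ R) :
    DifferentiableAt ℂ (regGammaMul F) s := by
  refine differentiableAt_regGammaMul (h.compl_mem_nhds hs') h.continuation.differentiableOn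
    fun hG => ?_
  obtain ⟨k, rfl⟩ := (Gamma_eq_zero_iff s).1 hG
  by_contra hF
  -- The circle encloses only poles strictly right of the line Re s = δ-c; poles on the line itself
  -- are excluded by c ≠ δ + k.
  refine hs' (h.circle.gamma_poles_inside k (lt_of_le_of_ne (by simpa using hs) fun he => ?_) hF)
  exact h.c_ne k (by linarith)

theorem differentiableAt_rieszTransform (h : Setting a b lam mu σa σb α β δ Q K F c z₀ R ρ)
    {s : ℂ} (hs : δ - c ≤ s.re) (hs' : s ∉ Metric.ball z₀ R) :
    DifferentiableAt ℂ (rieszTransform α β F ρ) s :=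
  (h.differentiableAt_reg hs hs').mul
    ((differentiable_inv_gammaProd β s).mul (differentiable_inv_Gamma_add ρ s))

theorem continuousOn_circlePart (h : Setting a b lam mu σa σb α β δ Q K F c z₀ R ρ) :
    ContinuousOn (circlePart lam α β F ρ) (Metric.sphere z₀ R) := by
  intro s hs
  have h1 := h.circle.subset_strip (Metric.sphere_subset_closedBall hs)
  have h2 : s ∉ Metric.ball z₀ R := fun h2 => by
    rw [mem_sphere_iff_norm] at hs
    rw [mem_ball_iff_norm] at h2
    linarith
  exact (((h.differentiableAt_rieszTransform h1.1.le h2).mul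
    (differentiableAt_id.const_cpow (Or.inl h.lam_ne_zero))).const_mul _
    ).continuousAt.continuousWithinAt

theorem differentiableAt_dualF (h : Setting a b lam mu σa σb α β δ Q K F c z₀ R ρ) {s : ℂ}
    (hs : s.re < δ - max 0 σb) : DifferentiableAt ℂ (dualF b mu α β δ Q ω) s := by
  have h0 : 0 < (δ - s : ℂ).re := by
    have := le_max_left 0 σb
    simp
    linarith
  have h1 : σb < (δ - s : ℂ).re := by
    have := le_max_right 0 σb
    simp
    linarith
  have hsub : DifferentiableAt ℂ (fun z : ℂ => (δ : ℂ) - z) s := by fun_prop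
  refine DifferentiableAt.mul ?_ (DifferentiableAt.mul ?_ ?_)
  · exact (DifferentiableAt.const_cpow (by fun_prop) (Or.inl h.Q_ne_zero)).const_mul ω
  · exact (differentiableAt_gammaProd (conjParam β) h.alpha_pos h.conj_beta_re h0).comp s hsub
  · exact (h.mu_freq.differentiableAt_dirichletSeries h.abscissa_b.conj h1).comp s hsub

theorem re_line_lt (h : Setting a b lam mu σa σb α β δ Q K F c z₀ R ρ) :
    δ - c < δ - max 0 σb := by
  have := max_lt h.c_pos h.lt_c_b
  linarith

theorem Gamma_ne_zero_line (h : Setting a b lam mu σa σb α β δ Q K F c z₀ R ρ) {s : ℂ}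
    (hs : s.re = δ - c) (k : ℕ) : s ≠ -k := by
  rintro rfl
  have := h.c_ne k
  simp at hs
  exact this (by linarith)

theorem continuous_lineDensity (h : Setting a b lam mu σa σb α β δ Q K F c z₀ R ρ) :
    Continuous (lineDensity b lam mu α β δ Q ω c ρ) := by
  refine continuous_iff_continuousAt.2 fun t => ?_
  have hre : (((δ - c : ℝ) : ℂ) + t * I).re = δ - c := by simp
  have hd : DifferentiableAt ℂ (fun s => (2 * Real.pi : ℂ)⁻¹ *
      (dualTransform b mu α β δ Q ω ρ s * (lam 0 : ℂ) ^ s)) ((δ - c : ℝ) + t * I) := by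
    refine DifferentiableAt.const_mul (DifferentiableAt.mul ?_
      (differentiableAt_id.const_cpow (Or.inl h.lam_ne_zero))) _
    exact ((differentiableAt_Gamma _ (h.Gamma_ne_zero_line hre)).mul
      (h.differentiableAt_dualF (hre.trans_lt h.re_line_lt))).mul
      ((differentiable_inv_gammaProd β _).mul (differentiable_inv_Gamma_add ρ _))
  exact ContinuousAt.comp (f := fun t : ℝ => ((δ - c : ℝ) : ℂ) + t * I) hd.continuousAt
    (by fun_prop)

/-- A vertically integrable function stays so after multiplication by the dual series. -/
theorem verticalIntegrable_mul_dirichletSeries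
    (h : Setting a b lam mu σa σb α β δ Q K F c z₀ R ρ) {f : ℂ → ℂ} (hf : VerticalIntegrable f c) :
    VerticalIntegrable (fun s => f s * dirichletSeries (fun n => conj (b n)) mu s) c := by
  obtain ⟨C, -, hC⟩ := h.mu_freq.exists_norm_dirichletSeries_le h.abscissa_b.conj (B := c) h.lt_c_b
  refine Integrable.mul_bdd (c := C) hf (Continuous.aestronglyMeasurable ?_)
    (Eventually.of_forall fun t => hC _ (by simp) (by simp))
  refine continuous_iff_continuousAt.2 fun t => ?_
  exact ContinuousAt.comp (f := fun t : ℝ => (c : ℂ) + t * I)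
    (h.mu_freq.differentiableAt_dirichletSeries h.abscissa_b.conj
      (by simpa using h.lt_c_b)).continuousAt (by fun_prop)

/-- Powers of `Q` and `lam 0` have constant modulus on the line. After t ↦ -t the density is, in
norm, a constant times the Riesz kernel times the dual series on Re s = c, where that series is
bounded. -/
theorem integrable_lineDensity (h : Setting a b lam mu σa σb α β δ Q K F c z₀ R ρ)
    (hR : VerticalIntegrable (rieszKernel α β δ ρ) c) :
    Integrable (lineDensity b lam mu α β δ Q ω c ρ) := by
  have h1 : Integrable fun t : ℝ => rieszKernel α β δ ρ (c + t * I) *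
      dirichletSeries (fun n => conj (b n)) mu (c + t * I) :=
    h.verticalIntegrable_mul_dirichletSeries hR
  have hQ := h.Q_pos
  have hL := h.lam_freq.pos 0
  refine (h1.comp_neg.norm.const_mul
    (‖(2 * Real.pi : ℂ)⁻¹‖ * (‖ω‖ * Q ^ (δ - 2 * (δ - c)) * lam 0 ^ (δ - c)))).mono'
    h.continuous_lineDensity.aestronglyMeasurable (Eventually.of_forall fun t => le_of_eq ?_)
  have e1 : (δ : ℂ) - ((δ - c : ℝ) + t * I) = c + (-t : ℝ) * I := by
    push_cast
    ring
  rw [lineDensity, dualTransform_eq_rieszKernel, e1]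
  simp only [norm_mul, norm_cpow_eq_rpow_re_of_pos hQ, norm_cpow_eq_rpow_re_of_pos hL]
  have e2 : (δ - 2 * ((δ - c : ℝ) + t * I) : ℂ).re = δ - 2 * (δ - c) := by simp
  have e3 : (((δ - c : ℝ) : ℂ) + t * I).re = δ - c := by simp
  rw [e2, e3]
  ring

theorem gammaProd_mul_inv (h : Setting a b lam mu σa σb α β δ Q K F c z₀ R ρ) {s : ℂ}
    (hs : 0 < s.re) : gammaProd α β s * (gammaProd α β s)⁻¹ = 1 :=
  mul_inv_cancel₀ (gammaProd_ne_zero_of_re_pos β h.alpha_pos h.beta_re hs)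

theorem F_eq (h : Setting a b lam mu σa σb α β δ Q K F c z₀ R ρ) {s : ℂ} (hs : 0 < s.re)
    (hsa : σa < s.re) (hs' : s ∉ Metric.ball z₀ R) :
    F s = dirichletSeries a lam s * gammaProd α β s :=
  h.continuation.eq_series s (fun hK => hs' (h.circle.singularities_inside hK)) (max_lt hs hsa)

theorem rieszTransform_eq (h : Setting a b lam mu σa σb α β δ Q K F c z₀ R ρ) {s : ℂ}
    (hs : 0 < s.re) (hsa : σa < s.re) (hs' : s ∉ Metric.ball z₀ R) :
    rieszTransform α β F ρ s = dirichletSeries a lam s * Gamma s / Gamma (s + ρ + 1) := by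
  rw [rieszTransform, regGammaMul_of_ne_zero (Gamma_ne_zero_of_re_pos hs), h.F_eq hs hsa hs']
  linear_combination (Gamma s * dirichletSeries a lam s * (Gamma (s + ρ + 1))⁻¹) *
    h.gammaProd_mul_inv hs

theorem cpow_div_eq (h : Setting a b lam mu σa σb α β δ Q K F c z₀ R ρ) {v : ℝ} (hv : 0 < v)
    (s : ℂ) : ((lam 0 / v : ℝ) : ℂ) ^ s = (lam 0 : ℂ) ^ s * (v : ℂ) ^ (-s) := by
  rw [ofReal_div, div_cpow_ofReal_nonneg (h.lam_freq.pos 0).le hv.le, cpow_neg, div_eq_mul_inv]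

/-- The residual term of the Riesz sum identity as a superposition of powers. -/
theorem residualQ_eq (h : Setting a b lam mu σa σb α β δ Q K F c z₀ R ρ) {v : ℝ} (hv : 0 < v) :
    (((lam 0 / v) ^ (-ρ) : ℝ) : ℂ) * residualQ α β F z₀ R ρ (lam 0 / v) =
      ∫ θ, circleDensity (circlePart lam α β F ρ) z₀ R θ *
        (v : ℂ) ^ (-circleMap z₀ R θ) ∂angleMeasure := by
  have hx : 0 < lam 0 / v := div_pos (h.lam_freq.pos 0) hv
  have hx0 : ((lam 0 / v : ℝ) : ℂ) ≠ 0 := by exact_mod_cast hx.ne'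
  rw [residualQ, circleIntegral_eq_integral_angle, ← integral_const_mul, ← integral_const_mul]
  refine integral_congr_ae ?_
  filter_upwards [ae_Gamma_circleMap_ne_zero z₀ h.circle.radius_pos.ne'] with θ hθ
  simp only [circleDensity, circlePart, rieszTransform, regGammaMul_of_ne_zero hθ, phiCont]
  have e1 : (((lam 0 / v) ^ (-ρ) : ℝ) : ℂ) * ((lam 0 / v : ℝ) : ℂ) ^ (circleMap z₀ R θ + ρ) =
      (lam 0 : ℂ) ^ circleMap z₀ R θ * (v : ℂ) ^ (-circleMap z₀ R θ) := by
    rw [ofReal_cpow hx.le, ← cpow_add _ _ hx0, ← h.cpow_div_eq hv]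
    congr 1
    push_cast
    ring
  simp only [div_eq_mul_inv] at e1 ⊢
  linear_combination (2 * Real.pi * I : ℂ)⁻¹ * deriv (circleMap z₀ R) θ * F (circleMap z₀ R θ) *
    (gammaProd α β (circleMap z₀ R θ))⁻¹ * Gamma (circleMap z₀ R θ) *
    (Gamma (circleMap z₀ R θ + ρ + 1))⁻¹ * e1

/-- The integral term of the Riesz sum identity as a superposition of powers. -/
theorem integralTerm_eq (h : Setting a b lam mu σa σb α β δ Q K F c z₀ R ρ)
    (hR : VerticalIntegrable (rieszKernel α β δ ρ) c) {v : ℝ} (hv : 0 < v) :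
    (((lam 0 / v) ^ (-ρ) : ℝ) : ℂ) * (ω * (((lam 0 / v) ^ (δ + ρ) / Q ^ δ : ℝ) : ℂ) *
      ∑' n, conj (b n) * mellinInv c (rieszKernel α β δ ρ) (mu n * (lam 0 / v) / Q ^ 2)) =
      ∫ t : ℝ, lineDensity b lam mu α β δ Q ω c ρ t * (v : ℂ) ^ (-(((δ - c : ℝ) : ℂ) + t * I)) := by
  have hx : 0 < lam 0 / v := div_pos (h.lam_freq.pos 0) hv
  have hx0 : ((lam 0 / v : ℝ) : ℂ) ≠ 0 := by exact_mod_cast hx.ne'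
  have hQ := h.Q_pos
  have hy : 0 < lam 0 / v / Q ^ 2 := by positivity
  simp only [mul_div_assoc (mu _)]
  -- Summation under the integral sign, then t ↦ -t, so that s ↦ δ-s carries Re s = c to Re s = δ-c
  -- with upward parametrisation.
  rw [(h.mu_freq.hasSum_mellinInv (h.mu_freq.summable_of_abscissa_lt h.abscissa_b.conj h.lt_c_b)
    hR hy).2, mellinInv, ← integral_neg_eq_self, real_smul, ← integral_const_mul,
    ← integral_const_mul, ← integral_const_mul]
  congr 1
  funext t
  set s : ℂ := ((δ - c : ℝ) : ℂ) + t * I with hs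
  have e1 : (c : ℂ) + (-t : ℝ) * I = δ - s := by
    rw [hs]
    push_cast
    ring
  rw [e1, lineDensity, ← hs, dualTransform_eq_rieszKernel, smul_eq_mul]
  have hxx : (((lam 0 / v) ^ (-ρ) : ℝ) : ℂ) * (((lam 0 / v) ^ (δ + ρ) : ℝ) : ℂ) *
      ((lam 0 / v : ℝ) : ℂ) ^ (-(δ - s)) = (lam 0 : ℂ) ^ s * (v : ℂ) ^ (-s) := by
    rw [← h.cpow_div_eq hv, ofReal_cpow hx.le, ofReal_cpow hx.le, ← cpow_add _ _ hx0,
      ← cpow_add _ _ hx0]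
    congr 1
    push_cast
    ring
  have hQQ : (((Q ^ δ : ℝ) : ℂ))⁻¹ * (((Q ^ 2 : ℝ) : ℂ) ^ (-(δ - s)))⁻¹ = (Q : ℂ) ^ (δ - 2 * s) := by
    rw [ofReal_pow, sq, mul_cpow_ofReal_nonneg hQ.le hQ.le, ofReal_cpow hQ.le, ← cpow_neg,
      mul_inv, ← cpow_neg, ← cpow_add _ _ h.Q_ne_zero, ← cpow_add _ _ h.Q_ne_zero]
    congr 1
    ring
  have hy' : ((lam 0 / v / Q ^ 2 : ℝ) : ℂ) ^ (-(δ - s)) =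
      ((lam 0 / v : ℝ) : ℂ) ^ (-(δ - s)) * (((Q ^ 2 : ℝ) : ℂ) ^ (-(δ - s)))⁻¹ := by
    rw [ofReal_div, div_cpow_ofReal_nonneg hx.le (by positivity), div_eq_mul_inv]
  rw [hy', ← hQQ, ofReal_div ((lam 0 / v) ^ (δ + ρ))]
  push_cast at hxx ⊢
  simp only [div_eq_mul_inv, one_mul, mul_inv] at hxx ⊢
  linear_combination (ω * ((Q ^ δ : ℝ) : ℂ)⁻¹ * ((2 : ℂ)⁻¹ * (Real.pi : ℂ)⁻¹) *
    (((Q : ℂ) ^ 2) ^ (-(δ - s)))⁻¹ * rieszKernel α β δ ρ (δ - s) *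
    dirichletSeries (fun n => conj (b n)) mu (δ - s)) * hxx

end Setting

end RieszModular

end

/-! ### The functional equation and the decay of Γ F. -/

noncomputable section

namespace RieszModular

open Topology

theorem exists_rpow_le {x : ℝ} (hx : 0 < x) (y : ℝ) :
    ∃ A, 0 ≤ A ∧ ∀ u : ℝ, |u| ≤ y → x ^ u ≤ A := by
  refine ⟨x ^ y + x ^ (-y), by positivity, fun u hu => ?_⟩
  have p1 := Real.rpow_pos_of_pos hx y
  have p2 := Real.rpow_pos_of_pos hx (-y)
  rcases le_total 1 x with h1 | h1
  · linarith [Real.rpow_le_rpow_of_exponent_le h1 (abs_le.1 hu).2]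
  · linarith [Real.rpow_le_rpow_of_exponent_ge hx h1 (abs_le.1 hu).1]

theorem notMem_closedBall_of_im {z₀ : ℂ} {R : ℝ} {s : ℂ}
    (hs : s.im < z₀.im - R ∨ z₀.im + R < s.im) : s ∉ Metric.closedBall z₀ R := by
  intro h1
  rw [mem_closedBall_iff_norm] at h1
  have := abs_le.1 ((abs_im_sub_le_norm s z₀).trans h1)
  rcases hs with hs | hs <;> linarith

/-- The half plane `x < Re s` without the square circumscribed to a disc. -/
def squareExterior (x : ℝ) (z₀ : ℂ) (R : ℝ) : Set ℂ :=
  {s | x < s.re ∧ ((s.re < z₀.re - R ∨ z₀.re + R < s.re) ∨ (s.im < z₀.im - R ∨ z₀.im + R < s.im))}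

theorem isOpen_squareExterior (x : ℝ) (z₀ : ℂ) (R : ℝ) : IsOpen (squareExterior x z₀ R) :=
  (isOpen_lt continuous_const continuous_re).inter
    (((isOpen_lt continuous_re continuous_const).union (isOpen_lt continuous_const continuous_re)).union
      ((isOpen_lt continuous_im continuous_const).union
        (isOpen_lt continuous_const continuous_im)))

theorem notMem_closedBall_of_mem_squareExterior {x : ℝ} {z₀ : ℂ} {R : ℝ} {s : ℂ}
    (hs : s ∈ squareExterior x z₀ R) : s ∉ Metric.closedBall z₀ R :=
  hs.2.elim notMem_closedBall_of_re notMem_closedBall_of_im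

/-- Removing a square instead of the disc leaves a union of four convex pieces, chained together
through explicit common points. -/
theorem isPreconnected_squareExterior {x : ℝ} {z₀ : ℂ} {R : ℝ} (hR : 0 < R)
    (hx : x < z₀.re - R) : IsPreconnected (squareExterior x z₀ R) := by
  have c1 : IsPreconnected {s : ℂ | x < s.re ∧ s.re < z₀.re - R} :=
    ((convex_halfSpace_re_gt x).inter (convex_halfSpace_re_lt _)).isPreconnected
  have c2 : IsPreconnected {s : ℂ | z₀.re + R < s.re} := (convex_halfSpace_re_gt _).isPreconnected
  have c3 : IsPreconnected {s : ℂ | x < s.re ∧ s.im < z₀.im - R} :=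
    ((convex_halfSpace_re_gt x).inter (convex_halfSpace_im_lt _)).isPreconnected
  have c4 : IsPreconnected {s : ℂ | x < s.re ∧ z₀.im + R < s.im} :=
    ((convex_halfSpace_re_gt x).inter (convex_halfSpace_im_gt _)).isPreconnected
  have c24 := c2.union (⟨z₀.re + R + 1, z₀.im + R + 1⟩ : ℂ) (by simp)
    (by exact ⟨by simp; linarith, by simp⟩) c4
  have c234 := c24.union (⟨z₀.re + R + 1, z₀.im - R - 1⟩ : ℂ) (Or.inl (by simp))
    (by exact ⟨by simp; linarith, by simp⟩) c3
  have c1234 := c234.union (⟨(x + (z₀.re - R)) / 2, z₀.im + R + 1⟩ : ℂ)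
    (Or.inl (Or.inr ⟨by simp; linarith, by simp⟩))
    (by constructor <;> (simp; linarith)) c1
  convert c1234 using 1
  ext s
  simp only [squareExterior, Set.mem_ofPred_eq, Set.mem_union]
  constructor
  · rintro ⟨h1, (h2 | h2) | (h2 | h2)⟩ <;> tauto
  · rintro (((h | h) | h) | h)
    · exact ⟨by linarith, Or.inl (Or.inr h)⟩
    all_goals tauto

namespace Setting

variable {r : ℕ} {a b : ℕ → ℂ} {lam mu : ℕ → ℝ} {σa σb : ℝ} {α : Fin r → ℝ} {β : Fin r → ℂ}
  {δ Q : ℝ} {ω : ℂ} {K : Set ℂ} {F : ℂ → ℂ} {c : ℝ} {z₀ : ℂ} {R ρ : ℝ}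

/-- The Cauchy transform of the residual term. -/
abbrev circleTransform (lam : ℕ → ℝ) (α : Fin r → ℝ) (β : Fin r → ℂ) (F : ℂ → ℂ) (z₀ : ℂ)
    (R ρ : ℝ) : ℂ → ℂ :=
  cauchyTransform angleMeasure (circleDensity (circlePart lam α β F ρ) z₀ R) (circleMap z₀ R)

/-- The Cauchy transform of the integral term. -/
abbrev lineTransform (b : ℕ → ℂ) (lam mu : ℕ → ℝ) (α : Fin r → ℝ) (β : Fin r → ℂ) (δ Q : ℝ)
    (ω : ℂ) (c ρ : ℝ) : ℂ → ℂ :=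
  cauchyTransform volume (lineDensity b lam mu α β δ Q ω c ρ)
    (fun t : ℝ => ((δ - c : ℝ) : ℂ) + t * I)

theorem scaledRiesz_eq (h : Setting a b lam mu σa σb α β δ Q K F c z₀ R ρ)
    (hRiesz : RieszSumIdentity a b lam mu α β δ Q ω F c z₀ R ρ) {v : ℝ} (hv : 0 < v) (s : ℂ) :
    (v : ℂ) ^ (s - 1) * scaledRiesz a lam ρ v =
      (∫ θ, circleDensity (circlePart lam α β F ρ) z₀ R θ *
        (v : ℂ) ^ (s - 1 - circleMap z₀ R θ) ∂angleMeasure) +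
      ∫ t : ℝ, lineDensity b lam mu α β δ Q ω c ρ t *
        (v : ℂ) ^ (s - 1 - (((δ - c : ℝ) : ℂ) + t * I)) := by
  have hv0 : (v : ℂ) ≠ 0 := by exact_mod_cast hv.ne'
  rw [scaledRiesz, hRiesz.2 _ (div_pos (h.lam_freq.pos 0) hv), mul_add, h.residualQ_eq hv,
    h.integralTerm_eq hRiesz.1 hv, mul_add, ← integral_const_mul, ← integral_const_mul]
  congr 2
  all_goals
    funext t
    rw [mul_left_comm, ← cpow_add _ _ hv0, ← sub_eq_add_neg]

theorem re_circleMap_bounds (h : Setting a b lam mu σa σb α β δ Q K F c z₀ R ρ) (θ : ℝ) :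
    z₀.re - R ≤ (circleMap z₀ R θ).re ∧ (circleMap z₀ R θ).re ≤ z₀.re + R := by
  have h1 : ‖circleMap z₀ R θ - z₀‖ = R := by simp [abs_of_pos h.circle.radius_pos]
  have := abs_le.1 ((abs_re_sub_le_norm (circleMap z₀ R θ) z₀).trans h1.le)
  constructor <;> linarith

theorem integrable_circleDensity_circlePart
    (h : Setting a b lam mu σa σb α β δ Q K F c z₀ R ρ) :
    Integrable (circleDensity (circlePart lam α β F ρ) z₀ R) angleMeasure :=
  integrable_circleDensity h.circle.radius_pos.le h.continuousOn_circlePart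

theorem measurable_line (x : ℝ) : Measurable fun t : ℝ => (x : ℂ) + t * I := by
  fun_prop

/-- Both sides compute the integral of v^(s-1) times the scaled Riesz mean over (0,1]: once from the
series, once from the Riesz identity. -/
theorem transform_eq_of_re_large (h : Setting a b lam mu σa σb α β δ Q K F c z₀ R ρ)
    (hRiesz : RieszSumIdentity a b lam mu α β δ Q ω F c z₀ R ρ) {s : ℂ} (hs : c < s.re) :
    (lam 0 : ℂ) ^ s * rieszTransform α β F ρ s =
      circleTransform lam α β F z₀ R ρ s + lineTransform b lam mu α β δ Q ω c ρ s := by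
  have hb := h.re_bounds
  have h0 := h.c_pos.trans hs
  have hsa := h.lt_c_a.trans hs
  have h1 := mellin_Ioc_superposition (s := s) h.integrable_circleDensity_circlePart
    (continuous_circleMap z₀ R).measurable (fun θ => (h.re_circleMap_bounds θ).2)
    (hb.2.trans hs)
  have h2 := mellin_Ioc_superposition (s := s) (h.integrable_lineDensity (ω := ω) hRiesz.1)
    (measurable_line (δ - c)) (A := c)
    (fun t => by simp; linarith [h.circle.radius_pos]) hs
  rw [h.rieszTransform_eq h0 hsa fun hm => notMem_closedBall_of_re (Or.inr (hb.2.trans hs))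
    (Metric.ball_subset_closedBall hm), ← mul_div_assoc, ← mul_assoc,
    ← h.lam_freq.integral_scaledRiesz h.abscissa_a h.rho_nonneg h0 hsa,
    circleTransform, lineTransform, ← h1.2, ← h2.2, ← integral_add h1.1 h2.1]
  exact setIntegral_congr_fun measurableSet_Ioc fun v hv => h.scaledRiesz_eq hRiesz hv.1 s

/-- The same integral over (1,∞), where the Riesz mean vanishes; the powers integrate to -1/(s-w)
there. -/
theorem transform_eq_zero_of_re_small (h : Setting a b lam mu σa σb α β δ Q K F c z₀ R ρ)
    (hRiesz : RieszSumIdentity a b lam mu α β δ Q ω F c z₀ R ρ) {s : ℂ} (hs : s.re < δ - c) :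
    circleTransform lam α β F z₀ R ρ s + lineTransform b lam mu α β δ Q ω c ρ s = 0 := by
  have hb := h.re_bounds
  have h1 := mellin_Ioi_superposition (s := s) h.integrable_circleDensity_circlePart
    (continuous_circleMap z₀ R).measurable (fun θ => (h.re_circleMap_bounds θ).1)
    (hs.trans hb.1)
  have h2 := mellin_Ioi_superposition (s := s) (h.integrable_lineDensity (ω := ω) hRiesz.1)
    (measurable_line (δ - c)) (A := δ - c) (fun t => by simp) hs
  have h3 := integral_add h1.1 h2.1
  rw [h1.2, h2.2] at h3
  have h4 : ∫ v in Set.Ioi (1 : ℝ), ((∫ θ, circleDensity (circlePart lam α β F ρ) z₀ R θ *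
        (v : ℂ) ^ (s - 1 - circleMap z₀ R θ) ∂angleMeasure) +
      ∫ t : ℝ, lineDensity b lam mu α β δ Q ω c ρ t *
        (v : ℂ) ^ (s - 1 - (((δ - c : ℝ) : ℂ) + t * I))) = 0 := by
    rw [← integral_zero ℝ ℂ (μ := volume.restrict (Set.Ioi (1 : ℝ)))]
    refine setIntegral_congr_fun measurableSet_Ioi fun v hv => ?_
    rw [← h.scaledRiesz_eq hRiesz (one_pos.trans hv) s, h.lam_freq.scaledRiesz_eq_zero hv, mul_zero]
  rw [h4] at h3
  linear_combination h3

theorem differentiableAt_lineTransform (h : Setting a b lam mu σa σb α β δ Q K F c z₀ R ρ)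
    (hR : VerticalIntegrable (rieszKernel α β δ ρ) c) {s : ℂ} (hs : δ - c < s.re) :
    DifferentiableAt ℂ (lineTransform b lam mu α β δ Q ω c ρ) s :=
  differentiableAt_cauchyTransform (h.integrable_lineDensity hR) (measurable_line (δ - c))
    (sub_pos.2 hs) fun t => by
      simpa using (le_abs_self _).trans
        (abs_re_le_norm (s - (((δ - c : ℝ) : ℂ) + t * I)))

/-- The integral representation of the continued Mellin transform. -/
theorem transform_eq (h : Setting a b lam mu σa σb α β δ Q K F c z₀ R ρ)
    (hRiesz : RieszSumIdentity a b lam mu α β δ Q ω F c z₀ R ρ) {s : ℂ}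
    (hs : s ∈ squareExterior (δ - c) z₀ R) :
    (lam 0 : ℂ) ^ s * rieszTransform α β F ρ s =
      circleTransform lam α β F z₀ R ρ s + lineTransform b lam mu α β δ Q ω c ρ s := by
  have hb := h.re_bounds
  have hR := h.circle.radius_pos
  have hopen := isOpen_squareExterior (δ - c) z₀ R
  have d1 : DifferentiableOn ℂ (fun s => (lam 0 : ℂ) ^ s * rieszTransform α β F ρ s)
      (squareExterior (δ - c) z₀ R) := fun z hz =>
    ((differentiableAt_id.const_cpow (Or.inl h.lam_ne_zero)).mul
      (h.differentiableAt_rieszTransform hz.1.le fun hm =>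
        notMem_closedBall_of_mem_squareExterior hz
          (Metric.ball_subset_closedBall hm))).differentiableWithinAt
  have d2 : DifferentiableOn ℂ (fun s => circleTransform lam α β F z₀ R ρ s +
      lineTransform b lam mu α β δ Q ω c ρ s) (squareExterior (δ - c) z₀ R) := fun z hz =>
    ((differentiableAt_cauchyTransform_circle hR.le h.continuousOn_circlePart
      (notMem_closedBall_of_mem_squareExterior hz)).add
      (h.differentiableAt_lineTransform hRiesz.1 hz.1)).differentiableWithinAt
  have hev : (fun s => (lam 0 : ℂ) ^ s * rieszTransform α β F ρ s) =ᶠ[𝓝 ((c + 1 : ℝ) : ℂ)]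
      fun s => circleTransform lam α β F z₀ R ρ s + lineTransform b lam mu α β δ Q ω c ρ s := by
    filter_upwards [(isOpen_lt continuous_const continuous_re).mem_nhds
      (show c < (((c + 1 : ℝ) : ℂ)).re by simp)] with z hz
    exact h.transform_eq_of_re_large hRiesz hz
  refine (d1.analyticOnNhd hopen).eqOn_of_preconnected_of_eventuallyEq (d2.analyticOnNhd hopen)
    (isPreconnected_squareExterior hR hb.1) ?_ hev hs
  refine ⟨?_, Or.inl (Or.inr ?_)⟩ <;> rw [ofReal_re] <;> linarith

/-- The functional equation for the Mellin transforms on the line `Re s = δ - c`. -/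
theorem rieszTransform_eq_dualTransform (h : Setting a b lam mu σa σb α β δ Q K F c z₀ R ρ)
    (hRiesz : RieszSumIdentity a b lam mu α β δ Q ω F c z₀ R ρ) (t : ℝ) :
    rieszTransform α β F ρ ((δ - c : ℝ) + t * I) =
      dualTransform b mu α β δ Q ω ρ ((δ - c : ℝ) + t * I) := by
  have hb := h.re_bounds
  set p : ℂ := ((δ - c : ℝ) : ℂ) + t * I with hp
  have hpre : p.re = δ - c := by simp [hp]
  have hball : p ∉ Metric.closedBall z₀ R :=
    notMem_closedBall_of_re (Or.inl (hpre.trans_lt hb.1))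
  have hball' : p ∉ Metric.ball z₀ R := fun hm => hball (Metric.ball_subset_closedBall hm)
  have hjump := tendsto_cauchyTransform_vertical_jump
    (h.integrable_lineDensity (ω := ω) hRiesz.1) (t₀ := t)
    h.continuous_lineDensity.continuousAt (δ - c)
  have hinv : Tendsto (fun k : ℝ => ((k⁻¹ : ℝ) : ℂ)) atTop (𝓝 0) :=
    (continuous_ofReal.tendsto' 0 0 ofReal_zero).comp tendsto_inv_atTop_zero
  have hplus : Tendsto (fun k : ℝ => p + (k⁻¹ : ℝ)) atTop (𝓝 p) := by
    simpa using hinv.const_add p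
  have hminus : Tendsto (fun k : ℝ => p - (k⁻¹ : ℝ)) atTop (𝓝 p) := by
    simpa using hinv.const_sub p
  have hcB : ContinuousAt (circleTransform lam α β F z₀ R ρ) p :=
    (differentiableAt_cauchyTransform_circle h.circle.radius_pos.le h.continuousOn_circlePart
      hball).continuousAt
  have hcM : ContinuousAt (fun s => (lam 0 : ℂ) ^ s * rieszTransform α β F ρ s) p :=
    ((differentiableAt_id.const_cpow (Or.inl h.lam_ne_zero)).mul
      (h.differentiableAt_rieszTransform hpre.ge hball')).continuousAt
  -- Right of the line the line transform is λ^s times `rieszTransform` minus the circle transform;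
  -- left of it, it is minus the circle transform. By continuity of the latter, the jump is λ^p
  -- times `rieszTransform` at p.
  have hlim := ((hcM.tendsto.comp hplus).sub (hcB.tendsto.comp hplus)).add
    (hcB.tendsto.comp hminus)
  have hinv' : Tendsto (fun k : ℝ => k⁻¹) atTop (𝓝 0) := tendsto_inv_atTop_zero
  have heq := tendsto_nhds_unique (hlim.congr' ?_) hjump
  · rw [lineDensity, ← hp] at heq
    have hpi : (2 * Real.pi : ℂ) ≠ 0 := by exact_mod_cast Real.two_pi_pos.ne'
    rw [mul_inv_cancel_left₀ hpi, sub_add_cancel, mul_comm] at heq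
    exact mul_right_cancel₀ ((cpow_ne_zero_iff_of_exponent_ne_zero (fun h0 => by
      have := h.Gamma_ne_zero_line hpre 0
      simp [h0] at this)).2 h.lam_ne_zero) heq
  · filter_upwards [eventually_gt_atTop 0,
      hinv'.eventually_lt_const (sub_pos.2 hb.1)] with k hk hk'
    have hk0 : 0 < k⁻¹ := inv_pos.2 hk
    have h1 := h.transform_eq hRiesz (s := p + (k⁻¹ : ℝ)) (by
      have : (p + (k⁻¹ : ℝ)).re = δ - c + k⁻¹ := by rw [add_re, hpre, ofReal_re]
      refine ⟨?_, Or.inl (Or.inl ?_)⟩ <;> rw [this] <;> linarith)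
    have h2 := h.transform_eq_zero_of_re_small hRiesz (s := p - (k⁻¹ : ℝ)) (by
      rw [sub_re, hpre, ofReal_re]
      linarith)
    simp only [Function.comp]
    linear_combination h1 + h2

/-- The functional equation for `F`. -/
theorem F_eq_dualF (h : Setting a b lam mu σa σb α β δ Q K F c z₀ R ρ)
    (hRiesz : RieszSumIdentity a b lam mu α β δ Q ω F c z₀ R ρ) {s : ℂ}
    (hs : s.re < min (z₀.re - R) (δ - max 0 σb)) : F s = dualF b mu α β δ Q ω s := by
  have hb := h.re_bounds
  set m := min (z₀.re - R) (δ - max 0 σb) with hm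
  have hopen : IsOpen {s : ℂ | s.re < m} := isOpen_lt continuous_re continuous_const
  have hcm : δ - c < m := lt_min hb.1 h.re_line_lt
  have d1 : DifferentiableOn ℂ F {s : ℂ | s.re < m} :=
    h.continuation.differentiableOn.mono fun z hz hK =>
      notMem_closedBall_of_re (Or.inl (lt_of_lt_of_le hz (min_le_left _ _)))
        (Metric.ball_subset_closedBall (h.circle.singularities_inside hK))
  have d2 : DifferentiableOn ℂ (dualF b mu α β δ Q ω) {s : ℂ | s.re < m} := fun z hz =>
    (h.differentiableAt_dualF (lt_of_lt_of_le hz (min_le_right _ _))).differentiableWithinAt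
  -- The line may meet poles of the Gamma factors, where the inverse product is zero and cannot be
  -- cancelled. Agreement above height `T` already has an accumulation point, which suffices for the
  -- identity theorem.
  obtain ⟨T, hT1, hT⟩ := gammaProd_ne_zero β h.alpha_pos
  have hline : ∀ t : ℝ, T ≤ |t| → F ((δ - c : ℝ) + t * I) =
      dualF b mu α β δ Q ω ((δ - c : ℝ) + t * I) := by
    intro t ht
    have him : (((δ - c : ℝ) : ℂ) + t * I).im = t := by simp
    have ht0 : t ≠ 0 := fun h0 => by
      rw [h0, abs_zero] at ht
      linarith
    have h1 := h.rieszTransform_eq_dualTransform hRiesz t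
    have g1 : Gamma (((δ - c : ℝ) : ℂ) + t * I) ≠ 0 :=
      Gamma_ne_zero (ne_neg_nat_of_im_ne_zero (by rwa [him]))
    have g2 : Gamma (((δ - c : ℝ) : ℂ) + t * I + ρ + 1) ≠ 0 :=
      Gamma_ne_zero (ne_neg_nat_of_im_ne_zero (by simpa using ht0))
    have g3 := hT (((δ - c : ℝ) : ℂ) + t * I) (by rwa [him])
    rw [rieszTransform, dualTransform, regGammaMul_of_ne_zero g1] at h1
    exact mul_left_cancel₀ g1
      (mul_right_cancel₀ (mul_ne_zero (inv_ne_zero g3) (inv_ne_zero g2)) h1)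
  have hfreq : ∃ᶠ z in 𝓝[≠] (((δ - c : ℝ) : ℂ) + (T + 1 : ℝ) * I),
      F z = dualF b mu α β δ Q ω z := by
    have htend : Tendsto (fun t : ℝ => ((δ - c : ℝ) : ℂ) + t * I) (𝓝[≠] (T + 1))
        (𝓝[≠] (((δ - c : ℝ) : ℂ) + (T + 1 : ℝ) * I)) := by
      refine ((Continuous.continuousAt (by fun_prop)).continuousWithinAt).tendsto_nhdsWithin ?_
      intro t ht h0
      exact ht (by simpa using congrArg im h0)
    refine htend.frequently (Eventually.frequently ?_)
    filter_upwards [nhdsWithin_le_nhds (lt_mem_nhds (lt_add_one T))] with t ht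
    exact hline t (ht.le.trans (le_abs_self t))
  refine (d1.analyticOnNhd hopen).eqOn_of_preconnected_of_frequently_eq (d2.analyticOnNhd hopen)
    (convex_halfSpace_re_lt m).isPreconnected ?_ hfreq hs
  simpa using hcm

/-- Decay of `Γ F` in the strip `δ - c ≤ Re s ≤ c`. -/
theorem exists_norm_reg_le (h : Setting a b lam mu σa σb α β δ Q K F c z₀ R ρ)
    (hRiesz : RieszSumIdentity a b lam mu α β δ Q ω F c z₀ R ρ) :
    ∃ C T, ∀ s : ℂ, δ - c ≤ s.re → s.re ≤ c → T ≤ |s.im| →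
      ‖regGammaMul F s‖ ≤ C / |s.im| ^ 2 := by
  have hb := h.re_bounds
  have hQ := h.Q_pos
  have hL := h.lam_freq.pos 0
  -- The strip is split at `c₁`: to its left the functional equation holds and the dual series
  -- converges absolutely; to its right points stay at distance at least `c₁ - (δ - c)` from the
  -- line carrying the density.
  obtain ⟨c₁, hc1, hc2⟩ := exists_between (lt_min hb.1 h.re_line_lt)
  have hlt0 : 0 < δ - c₁ := by
    have := hc2.trans_le (min_le_right _ _)
    linarith [le_max_left 0 σb]
  have hltb : σb < δ - c₁ := by
    have := hc2.trans_le (min_le_right _ _)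
    linarith [le_max_right 0 σb]
  -- left part, from the functional equation
  obtain ⟨A₁, hA₁0, hA₁⟩ := exists_norm_Gamma_le_div_pow (δ - c) c₁ 2
  obtain ⟨A₂, hA₂0, hA₂⟩ := exists_norm_gammaProd_le_of_re (conjParam β) (B := c) h.alpha_pos
    h.conj_beta_re hlt0
  obtain ⟨A₃, hA₃0, hA₃⟩ := h.mu_freq.exists_norm_dirichletSeries_le h.abscissa_b.conj (B := c) hltb
  obtain ⟨A₄, hA₄0, hA₄⟩ := exists_rpow_le (x := Q) hQ (|δ| + 2 * (|δ - c| + |c₁|))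
  -- right part, from the integral representation
  obtain ⟨B₁, hB₁0, hB₁⟩ := exists_norm_Gamma_le_div_pow (c₁ + ρ + 1) (c + ρ + 1) 2
  obtain ⟨B₂, T₂, hB₂0, hT₂, hB₂⟩ := exists_norm_gammaProd_le_of_im β h.alpha_pos c₁ c
  obtain ⟨T₃, hT₃, hne⟩ := gammaProd_ne_zero β h.alpha_pos
  obtain ⟨B₄, hB₄0, hB₄⟩ := exists_rpow_le (x := lam 0) hL (|c| + |c₁|)
  set D₁ := ∫ θ, ‖circleDensity (circlePart lam α β F ρ) z₀ R θ‖ ∂angleMeasure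
  set D₂ := ∫ t, ‖lineDensity b lam mu α β δ Q ω c ρ t‖
  have hD₁ : 0 ≤ D₁ := integral_nonneg fun _ => norm_nonneg _
  have hD₂ : 0 ≤ D₂ := integral_nonneg fun _ => norm_nonneg _
  set E₁ := A₁ * (‖ω‖ * A₄ * (A₂ * A₃)) with hE₁
  set E₂ := B₄ * (D₁ / 1 + D₂ / (c₁ - (δ - c))) * B₂ * B₁ with hE₂
  have hcc : 0 < c₁ - (δ - c) := sub_pos.2 hc1
  have hE₁0 : 0 ≤ E₁ := by positivity
  have hE₂0 : 0 ≤ E₂ := by positivity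
  -- Height above R + |Im z₀| + 1 keeps `s` at distance at least 1 from the circle; this is the
  -- denominator 1 in `E₂`.
  refine ⟨E₁ + E₂, max (max T₂ T₃) (R + |z₀.im| + 1), fun s h1 h2 h3 => ?_⟩
  have hsT2 : T₂ ≤ |s.im| := (le_max_left _ _).trans ((le_max_left _ _).trans h3)
  have hsT3 : T₃ ≤ |s.im| := (le_max_right _ _).trans ((le_max_left _ _).trans h3)
  have hsR : R + |z₀.im| + 1 ≤ |s.im| := (le_max_right _ _).trans h3
  have hs1 : 1 ≤ |s.im| := hT₂.trans hsT2
  have him : s.im ≠ 0 := fun h0 => by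
    rw [h0, abs_zero] at hs1
    linarith
  have hG : Gamma s ≠ 0 := Gamma_ne_zero (ne_neg_nat_of_im_ne_zero him)
  have hpos : 0 < |s.im| ^ 2 := by positivity
  rcases le_total s.re c₁ with hsc | hsc
  · refine le_trans ?_ (div_le_div_of_nonneg_right (le_add_of_nonneg_right hE₂0) hpos.le)
    rw [regGammaMul_of_ne_zero hG, h.F_eq_dualF hRiesz (hsc.trans_lt hc2), dualF, norm_mul,
      norm_mul, norm_mul, norm_mul, norm_cpow_eq_rpow_re_of_pos hQ, hE₁, mul_div_right_comm]
    have e1 : (δ - s : ℂ).re = δ - s.re := by simp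
    have e2 : (δ - 2 * s : ℂ).re = δ - 2 * s.re := by simp
    have hbs : |s.re| ≤ |δ - c| + |c₁| := by
      rw [abs_le]
      constructor
      · linarith [neg_abs_le (δ - c), abs_nonneg c₁]
      · linarith [le_abs_self c₁, abs_nonneg (δ - c)]
    gcongr
    · exact hA₁ s h1 hsc hs1
    · refine hA₄ _ ?_
      rw [e2]
      refine (abs_sub _ _).trans ?_
      rw [abs_mul, abs_two]
      linarith
    · exact hA₂ _ (by rw [e1]; linarith) (by rw [e1]; linarith)
    · exact hA₃ _ (by rw [e1]; linarith) (by rw [e1]; linarith)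
  · refine le_trans ?_ (div_le_div_of_nonneg_right (le_add_of_nonneg_left hE₁0) hpos.le)
    have hmem : s ∈ squareExterior (δ - c) z₀ R := by
      refine ⟨by linarith, Or.inr ?_⟩
      rcases le_total 0 s.im with h0 | h0
      · right
        rw [abs_of_nonneg h0] at hsR
        linarith [le_abs_self z₀.im]
      · left
        rw [abs_of_nonpos h0] at hsR
        linarith [neg_abs_le z₀.im]
    have hrep := h.transform_eq hRiesz hmem
    have g2 : Gamma (s + ρ + 1) ≠ 0 :=
      Gamma_ne_zero (ne_neg_nat_of_im_ne_zero (by simpa using him))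
    have g3 := hne s hsT3
    have g4 : (lam 0 : ℂ) ^ s * (lam 0 : ℂ) ^ (-s) = 1 := by
      rw [← cpow_add _ _ h.lam_ne_zero, add_neg_cancel, cpow_zero]
    -- Solving the integral representation for Γ F: both Cauchy transforms and the Gamma product are
    -- bounded here, so Γ(s+ρ+1) provides all the decay.
    have hreg : regGammaMul F s = (lam 0 : ℂ) ^ (-s) *
        (circleTransform lam α β F z₀ R ρ s + lineTransform b lam mu α β δ Q ω c ρ s) *
        gammaProd α β s * Gamma (s + ρ + 1) := by
      rw [← hrep, rieszTransform]
      field_simp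
      linear_combination (-regGammaMul F s) * g4
    have n1 : ‖circleTransform lam α β F z₀ R ρ s‖ ≤ D₁ / 1 :=
      norm_cauchyTransform_le h.integrable_circleDensity_circlePart one_pos fun θ => by
        have q1 := sub_le_norm_sub_circleMap (z₀ := z₀) h.circle.radius_pos.le s θ
        have q2 : |s.im| - |z₀.im| ≤ ‖s - z₀‖ :=
          (abs_sub_abs_le_abs_sub _ _).trans (abs_im_sub_le_norm s z₀)
        linarith
    have n2 : ‖lineTransform b lam mu α β δ Q ω c ρ s‖ ≤ D₂ / (c₁ - (δ - c)) :=
      norm_cauchyTransform_le (h.integrable_lineDensity hRiesz.1) hcc fun t => by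
        have q1 := abs_re_sub_le_norm s (((δ - c : ℝ) : ℂ) + t * I)
        have q2 : (((δ - c : ℝ) : ℂ) + t * I).re = δ - c := by simp
        rw [q2] at q1
        linarith [le_abs_self (s.re - (δ - c))]
    have e3 : (s + ρ + 1).re = s.re + ρ + 1 := by simp
    have e4 : (s + ρ + 1).im = s.im := by simp
    have n3 := hB₁ (s + ρ + 1) (by rw [e3]; linarith) (by rw [e3]; linarith) (by rwa [e4])
    rw [e4] at n3
    rw [hreg, norm_mul, norm_mul, norm_mul, norm_cpow_eq_rpow_re_of_pos hL, hE₂, mul_div_assoc]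
    gcongr
    · refine hB₄ _ ?_
      rw [neg_re, abs_neg, abs_le]
      constructor
      · linarith [neg_abs_le c₁, abs_nonneg c]
      · linarith [le_abs_self c, abs_nonneg c₁]
    · exact (norm_add_le _ _).trans (add_le_add n1 n2)
    · exact hB₂ s hsc h2 hsT2

end Setting

end RieszModular

end

/-! ### The two series as integrals of Γ F, and the conclusion. -/

namespace RieszModular.Setting

variable {r : ℕ} {a b : ℕ → ℂ} {lam mu : ℕ → ℝ} {σa σb : ℝ} {α : Fin r → ℝ} {β : Fin r → ℂ}
  {δ Q : ℝ} {ω : ℂ} {K : Set ℂ} {F : ℂ → ℂ} {c : ℝ} {z₀ : ℂ} {R ρ : ℝ}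

theorem verticalIntegrable_kernelY (h : Setting a b lam mu σa σb α β δ Q K F c z₀ R ρ) :
    VerticalIntegrable (kernelY α β) c := by
  obtain ⟨A, hA0, hA⟩ := exists_norm_Gamma_le_div_pow c c 2
  obtain ⟨B, hB0, hB⟩ := exists_norm_gammaProd_le_of_re β (B := c) h.alpha_pos h.beta_re h.c_pos
  have hre : ∀ t : ℝ, ((c : ℂ) + t * I).re = c := by simp
  refine integrable_of_norm_le_div_sq (T := 1) (C := A * B) ?_ fun t ht => ?_
  · refine continuous_iff_continuousAt.2 fun t => ?_
    have hpos : 0 < ((c : ℂ) + t * I).re := (hre t).symm ▸ h.c_pos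
    exact ContinuousAt.comp (f := fun t : ℝ => (c : ℂ) + t * I)
      ((differentiableAt_Gamma _ fun m hm => by
        have := congrArg re hm
        rw [hre] at this
        simp at this
        linarith [h.c_pos, (Nat.cast_nonneg m : (0 : ℝ) ≤ m)]).mul
      (differentiableAt_gammaProd β h.alpha_pos h.beta_re hpos)).continuousAt (by fun_prop)
  · have h1 := hA (c + t * I) (hre t).ge (hre t).le (by simpa using ht)
    rw [kernelY, norm_mul, mul_div_right_comm]
    refine mul_le_mul (by simpa using h1) (hB _ (hre t).ge (hre t).le) (norm_nonneg _) ?_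
    positivity

theorem verticalIntegrable_kernelX (h : Setting a b lam mu σa σb α β δ Q K F c z₀ R ρ) :
    VerticalIntegrable (kernelX δ α (conjParam β)) c := by
  obtain ⟨A, hA0, hA⟩ := exists_norm_Gamma_le_div_pow (δ - c) (δ - c) 2
  obtain ⟨B, hB0, hB⟩ := exists_norm_gammaProd_le_of_re (conjParam β) (B := c) h.alpha_pos
    h.conj_beta_re h.c_pos
  have hre : ∀ t : ℝ, ((c : ℂ) + t * I).re = c := by simp
  have hre' : ∀ t : ℝ, ((δ : ℂ) - (c + t * I)).re = δ - c := by simp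
  refine integrable_of_norm_le_div_sq (T := 1) (C := A * B) ?_ fun t ht => ?_
  · refine continuous_iff_continuousAt.2 fun t => ?_
    have hpos : 0 < ((c : ℂ) + t * I).re := (hre t).symm ▸ h.c_pos
    exact ContinuousAt.comp (f := fun t : ℝ => (c : ℂ) + t * I)
      (((differentiableAt_Gamma _ (h.Gamma_ne_zero_line (hre' t))).comp _ (by fun_prop)).mul
      (differentiableAt_gammaProd _ h.alpha_pos h.conj_beta_re hpos)).continuousAt (by fun_prop)
  · have h1 := hA (δ - (c + t * I)) (hre' t).ge (hre' t).le (by simpa using ht)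
    rw [kernelX, norm_mul, mul_div_right_comm]
    refine mul_le_mul (by simpa using h1) (hB _ (hre t).ge (hre t).le) (norm_nonneg _) ?_
    positivity

theorem residualP₁_eq (h : Setting a b lam mu σa σb α β δ Q K F c z₀ R ρ) (x : ℝ) :
    residualP₁ F z₀ R x =
      (2 * Real.pi * I : ℂ)⁻¹ * ∮ s in C(z₀, R), regGammaMul F s * (x : ℂ) ^ (-s) := by
  rw [residualP₁, circleIntegral_eq_integral_angle, circleIntegral_eq_integral_angle]
  congr 1
  refine integral_congr_ae ?_
  filter_upwards [ae_Gamma_circleMap_ne_zero z₀ h.circle.radius_pos.ne'] with θ hθ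
  simp only [circleDensity, regGammaMul_of_ne_zero hθ]

/-- The contour shift for `Γ(s) F(s) x ^ (-s)` from `Re s = c` to `Re s = δ - c`. -/
theorem integral_reg_sub (h : Setting a b lam mu σa σb α β δ Q K F c z₀ R ρ)
    (hRiesz : RieszSumIdentity a b lam mu α β δ Q ω F c z₀ R ρ) {x : ℝ} (hx : 0 < x) :
    I * ((∫ t : ℝ, regGammaMul F (c + t * I) * (x : ℂ) ^ (-((c : ℂ) + t * I))) -
      ∫ t : ℝ, regGammaMul F ((δ - c : ℝ) + t * I) * (x : ℂ) ^ (-(((δ - c : ℝ) : ℂ) + t * I))) =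
      ∮ s in C(z₀, R), regGammaMul F s * (x : ℂ) ^ (-s) := by
  obtain ⟨C, T, hC⟩ := h.exists_norm_reg_le hRiesz
  obtain ⟨A, hA0, hA⟩ := exists_rpow_le hx (|c| + |δ - c|)
  have hx0 : (x : ℂ) ≠ 0 := by exact_mod_cast hx.ne'
  refine integral_vertical_sub_eq_circleIntegral (g := fun s => regGammaMul F s * (x : ℂ) ^ (-s))
    (T := T) (C := C * A) h.circle.radius_pos h.circle.subset_strip (fun s h1 _ h3 => ?_)
    fun s h1 h2 h3 => ?_
  · exact (h.differentiableAt_reg h1 h3).mul (differentiableAt_id.neg.const_cpow (Or.inl hx0))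
  · have h4 := hC s h1 h2 h3
    rw [norm_mul, norm_cpow_eq_rpow_re_of_pos hx, mul_div_right_comm]
    refine mul_le_mul h4 (hA _ ?_) (Real.rpow_nonneg hx.le _) ((norm_nonneg _).trans h4)
    rw [neg_re, abs_neg, abs_le]
    constructor
    · linarith [neg_abs_le (δ - c), abs_nonneg c]
    · linarith [le_abs_self c, abs_nonneg (δ - c)]

/-- On Re s = c the Dirichlet series of φ converges absolutely, so termwise Mellin inversion
assembles Γ(s)F(s) under the integral. -/
theorem tsum_Y (h : Setting a b lam mu σa σb α β δ Q K F c z₀ R ρ) {x : ℝ} (hx : 0 < x) :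
    Summable (fun n => a n * Y c α β (lam n * x)) ∧
    ∑' n, a n * Y c α β (lam n * x) = (2 * Real.pi : ℂ)⁻¹ *
      ∫ t : ℝ, regGammaMul F (c + t * I) * (x : ℂ) ^ (-((c : ℂ) + t * I)) := by
  obtain ⟨h1, h2⟩ := h.lam_freq.hasSum_mellinInv
    (h.lam_freq.summable_of_abscissa_lt h.abscissa_a h.lt_c_a) h.verticalIntegrable_kernelY hx
  refine ⟨h1, h2.trans ?_⟩
  rw [mellinInv, real_smul]
  push_cast
  rw [one_div]
  congr 2
  funext t
  have hre : ((c : ℂ) + t * I).re = c := by simp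
  have h0 : 0 < ((c : ℂ) + t * I).re := by rw [hre]; exact h.c_pos
  rw [regGammaMul_of_ne_zero (Gamma_ne_zero_of_re_pos h0),
    h.F_eq h0 (by rw [hre]; exact h.lt_c_a) fun hm =>
      notMem_closedBall_of_re (Or.inr (h.re_bounds.2.trans_eq hre.symm))
        (Metric.ball_subset_closedBall hm), kernelY, smul_eq_mul]
  ring

/-- Termwise inversion on Re s = c followed by s ↦ δ-s; the functional equation then identifies the
integrand with Γ(s)F(s)x^(-s) on Re s = δ-c. -/
theorem tsum_X (h : Setting a b lam mu σa σb α β δ Q K F c z₀ R ρ)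
    (hRiesz : RieszSumIdentity a b lam mu α β δ Q ω F c z₀ R ρ) {x : ℝ} (hx : 0 < x) :
    Summable (fun n => conj (b n) * X δ c α (conjParam β) (mu n / (Q ^ 2 * x))) ∧
    ω / (((x * Q) ^ δ : ℝ) : ℂ) *
      ∑' n, conj (b n) * X δ c α (conjParam β) (mu n / (Q ^ 2 * x)) = (2 * Real.pi : ℂ)⁻¹ *
      ∫ t : ℝ, regGammaMul F ((δ - c : ℝ) + t * I) *
        (x : ℂ) ^ (-(((δ - c : ℝ) : ℂ) + t * I)) := by
  have hQ := h.Q_pos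
  have hx0 : (x : ℂ) ≠ 0 := by exact_mod_cast hx.ne'
  have hy : 0 < (Q ^ 2 * x)⁻¹ := by positivity
  obtain ⟨h1, h2⟩ := h.mu_freq.hasSum_mellinInv
    (h.mu_freq.summable_of_abscissa_lt h.abscissa_b.conj h.lt_c_b) h.verticalIntegrable_kernelX hy
  simp only [← div_eq_mul_inv] at h1 h2
  refine ⟨h1, ?_⟩
  simp only [X]
  rw [h2, mellinInv, real_smul, ← integral_neg_eq_self, ← integral_const_mul,
    ← integral_const_mul, ← integral_const_mul]
  congr 1
  funext t
  set s : ℂ := ((δ - c : ℝ) : ℂ) + t * I with hs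
  have hre : s.re = δ - c := by simp [hs]
  have e1 : (c : ℂ) + (-t : ℝ) * I = δ - s := by
    rw [hs]
    push_cast
    ring
  have hG : Gamma s ≠ 0 := Gamma_ne_zero (h.Gamma_ne_zero_line hre)
  rw [e1, regGammaMul_of_ne_zero hG, h.F_eq_dualF hRiesz
    (lt_min (hre.trans_lt h.re_bounds.1) (hre.trans_lt h.re_line_lt)), dualF, kernelX,
    sub_sub_cancel, smul_eq_mul]
  have hpow : ((((x * Q) ^ δ : ℝ) : ℂ))⁻¹ * (((Q ^ 2 * x)⁻¹ : ℝ) : ℂ) ^ (-(δ - s)) =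
      (Q : ℂ) ^ (δ - 2 * s) * (x : ℂ) ^ (-s) := by
    rw [Real.mul_rpow hx.le hQ.le, mul_inv, ofReal_mul, ofReal_mul, ofReal_inv, ofReal_inv,
      ← ofReal_inv, ← ofReal_inv, mul_cpow_ofReal_nonneg (by positivity) (by positivity),
      ofReal_cpow hx.le, ofReal_cpow hQ.le, mul_inv, ← cpow_neg, ← cpow_neg]
    have i1 : ((x⁻¹ : ℝ) : ℂ) ^ (-(δ - s)) = (x : ℂ) ^ (δ - s) := by
      rw [ofReal_inv, inv_cpow _ _ (by rw [arg_ofReal_of_nonneg hx.le]; exact Real.pi_pos.ne),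
        ← cpow_neg, neg_neg]
    have i2 : (((Q ^ 2)⁻¹ : ℝ) : ℂ) ^ (-(δ - s)) = (Q : ℂ) ^ (δ - s) * (Q : ℂ) ^ (δ - s) := by
      rw [ofReal_inv, inv_cpow _ _ (by
        rw [arg_ofReal_of_nonneg (by positivity)]; exact Real.pi_pos.ne), ← cpow_neg, neg_neg, sq,
        ofReal_mul, mul_cpow_ofReal_nonneg hQ.le hQ.le]
    rw [i1, i2, show (δ : ℂ) - 2 * s = -δ + (δ - s) + (δ - s) by ring,
      show -s = -(δ : ℂ) + (δ - s) by ring, cpow_add _ _ h.Q_ne_zero, cpow_add _ _ h.Q_ne_zero,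
      cpow_add _ _ hx0]
    ring
  rw [div_eq_mul_inv]
  push_cast at hpow ⊢
  rw [one_div]
  linear_combination (ω * (2 * Real.pi : ℂ)⁻¹ * Gamma s * gammaProd α (conjParam β) (δ - s) *
    dirichletSeries (fun n => conj (b n)) mu (δ - s)) * hpow

end RieszModular.Setting

open RieszModular in
theorem theorem1p4 {r : ℕ} (a b : ℕ → ℂ) (lam mu : ℕ → ℝ)
    (hlam : IsFrequency lam) (hmu : IsFrequency mu)
    (σa σb : ℝ) (hσa : IsAbscissa a lam σa) (hσb : IsAbscissa b mu σb)
    (α : Fin r → ℝ) (hα : ∀ i, 0 < α i) (β : Fin r → ℂ) (hβ : ∀ i, 0 ≤ (β i).re)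
    (δ Q : ℝ) (hδ : 0 < δ) (hQ : 0 < Q) (ω : ℂ) (hω : ‖ω‖ = 1)
    (K : Set ℂ) (F : ℂ → ℂ) (hF : IsCompletedContinuation a lam σa α β K F)
    -- the line of integration `Re s = c`, which avoids the poles of `Γ(δ - s)`
    (c : ℝ) (hc : max 0 (max σa σb) < c) (hcδ : ∀ k : ℕ, c ≠ δ + k)
    (z₀ : ℂ) (R : ℝ) (hC : IsAdmissibleCircle δ c K F z₀ R)
    (ρ : ℝ) (hρ0 : 0 ≤ ρ) (hρ : (2 * σb - δ) * (∑ i, α i) - 1 / 2 < ρ)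
    (hRiesz : RieszSumIdentity a b lam mu α β δ Q ω F c z₀ R ρ) :
    VerticalIntegrable (kernelY α β) c ∧
    VerticalIntegrable (kernelX δ α (fun i => conj (β i))) c ∧
    ∀ x : ℝ, 0 < x →
      Summable (fun n => a n * Y c α β (lam n * x)) ∧
      Summable (fun n => conj (b n) * X δ c α (fun i => conj (β i)) (mu n / (Q ^ 2 * x))) ∧
      ∑' n, a n * Y c α β (lam n * x) =
        residualP₁ F z₀ R x +
          ω / (((x * Q) ^ δ : ℝ) : ℂ) *
            ∑' n, conj (b n) * X δ c α (fun i => conj (β i)) (mu n / (Q ^ 2 * x)) := by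
  have h0 := (le_max_left 0 (max σa σb)).trans_lt hc
  have hmax := (le_max_right 0 (max σa σb)).trans_lt hc
  have h : Setting a b lam mu σa σb α β δ Q K F c z₀ R ρ :=
    { lam_freq := hlam, mu_freq := hmu, abscissa_a := hσa, abscissa_b := hσb, alpha_pos := hα
      beta_re := hβ, Q_pos := hQ, continuation := hF, c_pos := h0
      lt_c_a := (le_max_left _ _).trans_lt hmax, lt_c_b := (le_max_right _ _).trans_lt hmax
      c_ne := hcδ, circle := hC, rho_nonneg := hρ0 }
  refine ⟨h.verticalIntegrable_kernelY, h.verticalIntegrable_kernelX, fun x hx => ?_⟩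
  obtain ⟨hY, hYsum⟩ := h.tsum_Y hx
  obtain ⟨hX, hXsum⟩ := h.tsum_X hRiesz hx
  refine ⟨hY, hX, ?_⟩
  -- All three terms are now integrals of the same function, so the contour shift gives the
  -- identity; the factor I comes from ds = I dt.
  rw [hYsum, hXsum, h.residualP₁_eq, ← h.integral_reg_sub hRiesz hx,
    mul_inv (2 * (Real.pi : ℂ)) I, mul_assoc (2 * (Real.pi : ℂ))⁻¹, inv_mul_cancel_left₀ I_ne_zero]
  ring
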